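/- **Setting.** Let $\mathbb K$ be a field of characteristic zero. An *indexed set* is a family $X=(X(k))_{k\ge 1}$ of sets. A *tree monomial* of arity $n$ on $X$ is a planar rooted tree whose vertices with $k$ children are labelled by elements of $X(k)$, whose leaves are labelled bijectively by $\{1,\dots,n\}$, and such that at each vertex the minimal leaf labels of the children increase from left to right; it is *trivial* if it has no vertex. Linear combinations of tree monomials of arity $n$ on $X_0$ form the $n$-ary part of the free shuffle operad $X_0^{Ш}$ (the $0$-cells); $\operatorname{supp}(a)$ is the set of tree monomials occurring in $a$. A *one-hole* (resp. *two-hole*) *context* is a tree monomial on $X_0$ with one (resp. two) additional vertices, the holes, each used exactly once; $\Gamma[a]$ and $\Theta[a,b]$ denote the (multi)linear insertion in the holes. **Polygraphs.** A shuffle $1$-polygraph consists of indexed sets $X_0$, $X_1$ and, for each $\alpha\in X_1(k)$, two $0$-cells $s_0(\alpha),t_0(\alpha)$ of arity $k$. The $1$-cells of the free shuffle $1$-operad $X_1^{Ш}$ are the linear combinations of *$1$-monomials* $\Gamma[\alpha]$ ($\Gamma$ a one-hole context, $\alpha\in X_1$) and of identities $1_c$ ($c$ a $0$-cell; $1_c$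 linear in $c$), modulo the linear exchange relation $$\Theta[f,s_0(g)]+\Theta[t_0(f),g]-\Theta[t_0(f),s_0(g)]=\Theta[s_0(f),g]+\Theta[f,t_0(g)]-\Theta[s_0(f),t_0(g)] ;$$ composition is $f\star_0 g=f-1_{t_0(f)}+g$ when $t_0(f)=s_0(g)$. A shuffle $2$-polygraph has in addition an indexed set $X_2$ whose elements $A$ have parallel $1$-cells $s_1(A),t_1(A)$ as source and target; the $2$-cells are the linear combinations of the $\Gamma[A]$ and of identities of $1$-cells, modulo the same exchange relation, with the induced source and target maps $s_1,t_1$. **Rewriting.** $X$ is *left-monomial* if, for every $\alpha\in X_1$, $s_0(\alpha)$ is a nontrivial tree monomial not in $\operatorname{supp}(t_0(\alpha))$. It is *terminating* if the smallest order relation $\prec_{X_1}$ on tree monomials that is stable by product and satisfies $v\prec_{X_1} s_0(\alpha)$ for all $\alpha\in X_1$ and $v\in\operatorname{supp}(t_0(\alpha))$ is well-founded. A *rewriting step* is a $1$-cell $\lambda g+1_c$ with $\lambda\in\mathbb K\setminus\{0\}$, $g$ a $1$-monomial and $s_0(g)\notin\operatorname{supp}(c)$. A $1$-cell is *positive* if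 it is a (possibly empty) $\star_0$-composition of rewriting steps. A *branching* is a pair $(f,g)$ of positive $1$-cells with the same source; it is *local* if $f,g$ are rewriting steps. It is *coherently confluent* if there are positive $1$-cells $h,k$ and a $2$-cell $F:f\star_0h\Rightarrow g\star_0k$. The $2$-polygraph $X$ is *coherently confluent* if all its branchings are. **Essential branchings.** A local branching is *aspherical* if it is $(f,f)$; *additive* if it is $(\lambda f+\mu1_v+1_c,\lambda1_u+\mu g+1_c)$ with $1$-monomials $f,g$ of sources $u\ne v$ not in $\operatorname{supp}(c)$ and $\lambda,\mu\neq0$; *multiplicative* if it is $(\lambda\Theta[f,1_v]+1_c,\lambda\Theta[1_u,g]+1_c)$ with a two-hole context $\Theta$, $1$-monomials $f,g$ of sources $u,v$, $\lambda\ne0$ and $\Theta[u,v]\notin\operatorname{supp}(c)$; and *intersecting* otherwise. Set $(f,g)\sqsubseteq(\Gamma[f]+1_c,\Gamma[g]+1_c)$ for all one-hole contexts $\Gamma$ and $0$-cells $c$. A *critical branching* is an intersecting branching that is minimal for $\sqsubseteq$, that is, every intersecting branching $\sqsubseteq$-below it is also $\sqsubseteq$-above it. Fix a total order on $X_0\sqcup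 X_1$ with $\alpha<x$ for all $\alpha\in X_1$, $x\in X_0$, and a total order on permutations. The *path-lexicographic order* $\prec_{pl}$ on $1$-monomials, seen as tree monomials on $X_0\sqcup X_1$ with exactly one vertex in $X_1$, compares lexicographically the sequences $(p_1,\dots,p_n)$, where $p_i$ is the word of labels on the path from the root to the leaf $i$ and words are compared lexicographically, and then, in case of equality, the permutations formed by the leaf labels. An *essential branching* is a critical branching $(p,q)$ of two $1$-monomials with $p\prec_{pl}q$ such that no $1$-monomial $r$ with the same source satisfies $p\prec_{pl}r\prec_{pl}q$. **Theorem (coherent essential branchings theorem).** Let $X$ be a shuffle $2$-polygraph whose underlying $1$-polygraph is terminating and left-monomial. Assume that for every critical branching $(p,q)$ of two $1$-monomials only finitely many $1$-monomials $r$ with the same source satisfy $p\prec_{pl}r\prec_{pl}q$ (this holds, for instance, if every tree monomial is the source of finitely many $1$-generators). If every essential branching of $X$ is coherently confluent, then $X$ is coherently confluent. -/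

import Mathlib

universe u v

namespace ShufflePoly

/-- Planar trees whose inner vertices of arity `k` carry labels in `X k` and whose leaves carry
labels in `L`. -/
inductive Tree (X : ℕ+ → Type u) (L : Type) : Type u
  | leaf : L → Tree X L
  | node : {k : ℕ+} → X k → (Fin k → Tree X L) → Tree X L

namespace Tree

variable {X Y Z : ℕ+ → Type u} {L M N : Type}

/-- Grafting: every leaf `l` is replaced by the tree `v l`. -/
def bind : Tree X L → (L → Tree X M) → Tree X M
  | leaf l, v => v l
  | node x ch, v => node x (fun i => (ch i).bind v)

/-- The labels of the leaves, from left to right. -/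
def leaves : Tree X L → List L
  | leaf l => [l]
  | node _ ch => (List.ofFn (fun i => (ch i).leaves)).flatten

/-- At every vertex, the least leaf labels of the children increase from left to right. -/
def IsShuffle [LinearOrder L] : Tree X L → Prop
  | leaf _ => True
  | node _ ch => (∀ i, (ch i).IsShuffle) ∧
      ∀ i j, i < j → ∃ a ∈ (ch i).leaves, ∀ b ∈ (ch j).leaves, a < b

/-- The total weight of the vertices, where a vertex labelled `x` weighs `w x`. -/
def count (w : ∀ k, X k → ℕ) : Tree X L → ℕ
  | leaf _ => 0
  | node x ch => w _ x + ∑ i, (ch i).count w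

/-- Every vertex `x` is replaced by the tree `σ x`, whose leaf `i` receives the `i`-th child. -/
def subst (σ : ∀ k, X k → Tree Y (Fin k)) : Tree X L → Tree Y L
  | leaf l => leaf l
  | node x ch => (σ _ x).bind (fun i => (ch i).subst σ)

/-- The leaves from left to right, each with the word of labels on the path from the root. -/
def paths : Tree X L → List (L × List (Σ k, X k))
  | leaf l => [(l, [])]
  | node x ch => (List.ofFn (fun i => (ch i).paths)).flatten.map (fun p => (p.1, ⟨_, x⟩ :: p.2))

/-- Every element of `Fin n` labels exactly one leaf, and the shuffle condition holds. -/
def IsShuffleMonomial {n : ℕ+} (t : Tree X (Fin n)) : Prop :=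
  t.IsShuffle ∧ t.leaves.Nodup ∧ ∀ i, i ∈ t.leaves

theorem bind_leaf (t : Tree X L) : t.bind leaf = t := by
  induction t with
  | leaf l => rfl
  | node x ch ih => simp only [bind, ih]

theorem bind_bind (t : Tree X L) (f : L → Tree X M) (g : M → Tree X N) :
    (t.bind f).bind g = t.bind (fun l => (f l).bind g) := by
  induction t with
  | leaf l => rfl
  | node x ch ih => simp only [bind, ih]

theorem mem_leaves_node {k : ℕ+} (x : X k) (ch : Fin k → Tree X L) (l : L) :
    l ∈ (node x ch).leaves ↔ ∃ i, l ∈ (ch i).leaves := by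
  simp [leaves, List.mem_ofFn]

theorem leaves_bind (t : Tree X L) (v : L → Tree X M) :
    (t.bind v).leaves = t.leaves.flatMap (fun l => (v l).leaves) := by
  induction t with
  | leaf l => simp [bind, leaves]
  | node x ch ih =>
    simp only [bind, leaves, ih]
    rw [List.flatMap_def, List.map_flatten, List.flatten_flatten, List.map_map, List.map_ofFn]
    congr 1

theorem leaves_ne_nil (t : Tree X L) : t.leaves ≠ [] := by
  induction t with
  | leaf l => simp [leaves]
  | @node k x ch ih =>
    obtain ⟨l, hl⟩ := List.exists_mem_of_ne_nil _ (ih ⟨0, k.pos⟩)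
    exact List.ne_nil_of_mem ((mem_leaves_node x ch l).2 ⟨_, hl⟩)

theorem exists_least [LinearOrder L] (t : Tree X L) : ∃ a ∈ t.leaves, ∀ b ∈ t.leaves, a ≤ b := by
  classical
  obtain ⟨l, hl⟩ := List.exists_mem_of_ne_nil _ t.leaves_ne_nil
  obtain ⟨a, ha, h⟩ := t.leaves.toFinset.exists_min_image id ⟨l, by simpa using hl⟩
  exact ⟨a, by simpa using ha, fun b hb => h b (by simpa using hb)⟩

theorem isShuffle_bind [LinearOrder L] [LinearOrder M] (t : Tree X L) (v : L → Tree X M)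
    (ht : t.IsShuffle) (hv : ∀ l, (v l).IsShuffle)
    (hlt : ∀ i j, i < j → ∃ a ∈ (v i).leaves, ∀ b ∈ (v j).leaves, a < b) :
    (t.bind v).IsShuffle := by
  induction t with
  | leaf l => exact hv l
  | node x ch ih =>
    refine ⟨fun i => ih i (ht.1 i), fun i j hij => ?_⟩
    obtain ⟨p, hp, hpq⟩ := ht.2 i j hij
    obtain ⟨a, ha, hmin⟩ := (v p).exists_least
    simp only [leaves_bind, List.mem_flatMap]
    refine ⟨a, ⟨p, hp, ha⟩, ?_⟩
    rintro b ⟨q, hq, hb⟩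
    obtain ⟨c, hc, hcb⟩ := hlt p q (hpq q hq)
    exact (hmin c hc).trans_lt (hcb b hb)

theorem mem_leaves_subst (σ : ∀ k, X k → Tree Y (Fin k)) (hσ : ∀ k x, (σ k x).IsShuffleMonomial)
    (t : Tree X L) (l : L) : l ∈ (t.subst σ).leaves ↔ l ∈ t.leaves := by
  induction t with
  | leaf l => simp [subst, leaves]
  | node x ch ih =>
    simp only [subst, leaves_bind, List.mem_flatMap, ih, mem_leaves_node]
    exact ⟨fun ⟨i, _, h⟩ => ⟨i, h⟩, fun ⟨i, h⟩ => ⟨i, (hσ _ x).2.2 i, h⟩⟩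

theorem isShuffle_subst [LinearOrder L] (σ : ∀ k, X k → Tree Y (Fin k))
    (hσ : ∀ k x, (σ k x).IsShuffleMonomial) (t : Tree X L) (ht : t.IsShuffle) :
    (t.subst σ).IsShuffle := by
  induction t with
  | leaf l => trivial
  | node x ch ih =>
    refine isShuffle_bind _ _ (hσ _ x).1 (fun i => ih i (ht.1 i)) fun i j hij => ?_
    simpa only [mem_leaves_subst σ hσ] using ht.2 i j hij

theorem nodup_leaves_subst (σ : ∀ k, X k → Tree Y (Fin k))
    (hσ : ∀ k x, (σ k x).IsShuffleMonomial) (t : Tree X L) (ht : t.leaves.Nodup) :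
    (t.subst σ).leaves.Nodup := by
  induction t with
  | leaf l => simp [subst, leaves]
  | node x ch ih =>
    simp only [leaves, List.nodup_flatten, List.mem_ofFn, forall_exists_index,
      forall_apply_eq_imp_iff] at ht
    have hd : ∀ i j, i ≠ j → List.Disjoint (ch i).leaves (ch j).leaves := by
      have h := List.pairwise_ofFn.1 ht.2
      intro i j hij
      rcases lt_or_gt_of_ne hij with h' | h'
      · exact h h'
      · exact (h h').symm
    simp only [subst, leaves_bind]
    refine List.nodup_flatMap.2 ⟨fun i _ => ih i (ht.1 i), ?_⟩
    refine ((hσ _ x).2.1).imp fun {i j} hij => ?_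
    intro a ha hb
    rw [mem_leaves_subst σ hσ] at ha hb
    exact hd i j hij ha hb

theorem IsShuffleMonomial.subst {n : ℕ+} (σ : ∀ k, X k → Tree Y (Fin k))
    (hσ : ∀ k x, (σ k x).IsShuffleMonomial) {t : Tree X (Fin n)} (ht : t.IsShuffleMonomial) :
    (t.subst σ).IsShuffleMonomial :=
  ⟨isShuffle_subst σ hσ t ht.1, nodup_leaves_subst σ hσ t ht.2.1,
    fun i => (mem_leaves_subst σ hσ t i).2 (ht.2.2 i)⟩

theorem subst_bind (σ : ∀ k, X k → Tree Y (Fin k)) (t : Tree X L) (v : L → Tree X M) :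
    (t.bind v).subst σ = (t.subst σ).bind (fun l => (v l).subst σ) := by
  induction t with
  | leaf l => rfl
  | node x ch ih => simp only [bind, subst, ih, bind_bind]

theorem subst_subst (σ : ∀ k, X k → Tree Y (Fin k)) (τ : ∀ k, Y k → Tree Z (Fin k))
    (t : Tree X L) : (t.subst σ).subst τ = t.subst (fun k x => (σ k x).subst τ) := by
  induction t with
  | leaf l => rfl
  | node x ch ih => simp only [subst, subst_bind, ih]

theorem count_bind (w : ∀ k, X k → ℕ) (t : Tree X L) (v : L → Tree X M) :
    (t.bind v).count w = t.count w + (t.leaves.map (fun l => (v l).count w)).sum := by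
  induction t with
  | leaf l => simp [bind, count, leaves]
  | node x ch ih =>
    simp only [bind, count, ih, leaves, Finset.sum_add_distrib, List.map_flatten,
      List.sum_flatten, List.map_ofFn, List.sum_ofFn, add_assoc]
    rfl

theorem count_subst (w : ∀ k, Y k → ℕ) (σ : ∀ k, X k → Tree Y (Fin k))
    (hσ : ∀ k x, (σ k x).IsShuffleMonomial) (t : Tree X L) :
    (t.subst σ).count w = t.count (fun k x => (σ k x).count w) := by
  induction t with
  | leaf l => rfl
  | node x ch ih =>
    simp only [subst, count, count_bind, ih]
    congr 1
    rw [← List.sum_toFinset _ (hσ _ x).2.1]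
    refine Finset.sum_congr ?_ fun _ _ => rfl
    ext i
    simpa using (hσ _ x).2.2 i

end Tree

/-- Shuffle tree monomials of arity `n` on the indexed set `X`. -/
def ShTree (X : ℕ+ → Type u) (n : ℕ+) : Type u :=
  {t : Tree X (Fin n) // t.IsShuffleMonomial}

namespace ShTree

variable {X Y Z : ℕ+ → Type u} {n k : ℕ+}

/-- The tree monomial with one vertex, labelled `x`. -/
def corolla (x : X k) : ShTree X k :=
  ⟨Tree.node x (fun i => Tree.leaf i), by
    refine ⟨⟨fun _ => trivial, fun i j hij => ⟨i, by simp [Tree.leaves], ?_⟩⟩, ?_, ?_⟩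
    · simpa [Tree.leaves] using hij
    · have h : (List.ofFn fun i : Fin k => [i]).flatten = List.ofFn fun i : Fin k => i := by
        rw [← List.flatMap_singleton' (List.ofFn fun i : Fin k => i), List.flatMap_def,
          List.map_ofFn]
        rfl
      simp only [Tree.leaves, h]
      exact List.nodup_ofFn.2 fun _ _ h => h
    · intro i
      simp [Tree.leaves]⟩

/-- The simultaneous insertion of the tree monomials `σ x` at the vertices `x`. -/
def subst (σ : ∀ k, X k → ShTree Y k) (t : ShTree X n) : ShTree Y n :=
  ⟨t.1.subst (fun k x => (σ k x).1), t.2.subst _ (fun k x => (σ k x).2)⟩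

/-- Relabelling of the vertices. -/
def map (f : ∀ k, X k → Y k) : ShTree X n → ShTree Y n :=
  subst (fun k x => corolla (f k x))

/-- The total weight of the vertices. -/
def count (w : ∀ k, X k → ℕ) (t : ShTree X n) : ℕ := t.1.count w

/-- The trivial tree monomial is the one without vertices. -/
def IsTrivial (t : ShTree X n) : Prop := ∃ i, t.1 = Tree.leaf i

/-- The word of vertex labels on the path from the root to the input `i`. -/
def pathWord (t : ShTree X n) (i : Fin n) : List (Σ k, X k) := (t.1.paths.lookup i).getD []

/-- The sequence of the path words of the inputs `1, …, n`. -/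
def pathWords (t : ShTree X n) : List (List (Σ k, X k)) := List.ofFn t.pathWord

/-- The permutation of the inputs: it sends `i` to the label of the `i`-th leaf from the left. -/
def inputPerm (t : ShTree X n) : Equiv.Perm (Fin n) :=
  (finCongr (by
    have h := Fintype.card_congr (t.2.2.1.getEquivOfForallMemList _ t.2.2.2)
    simpa using h.symm)).trans (t.2.2.1.getEquivOfForallMemList _ t.2.2.2)

theorem subst_subst (σ : ∀ k, X k → ShTree Y k) (τ : ∀ k, Y k → ShTree Z k) (t : ShTree X n) :
    (t.subst σ).subst τ = t.subst (fun k x => (σ k x).subst τ) :=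
  Subtype.ext (Tree.subst_subst _ _ _)

theorem corolla_subst (σ : ∀ k, X k → ShTree Y k) (x : X k) : (corolla x).subst σ = σ k x :=
  Subtype.ext (by simp only [subst, corolla, Tree.subst]; exact Tree.bind_leaf _)

theorem subst_corolla (t : ShTree X n) : t.subst (fun _ x => corolla x) = t := by
  refine Subtype.ext ?_
  obtain ⟨t, ht⟩ := t
  simp only [subst]
  clear ht
  induction t with
  | leaf l => rfl
  | node x ch ih => exact congrArg (Tree.node x) (funext ih)

theorem count_subst (w : ∀ k, Y k → ℕ) (σ : ∀ k, X k → ShTree Y k) (t : ShTree X n) :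
    (t.subst σ).count w = t.count (fun _ x => (σ _ x).count w) :=
  Tree.count_subst _ _ (fun k x => (σ k x).2) _

theorem count_corolla (w : ∀ k, X k → ℕ) (x : X k) : (corolla x).count w = w k x := by
  simp [count, corolla, Tree.count]

theorem count_zero (t : ShTree X n) : t.count (fun _ _ => 0) = 0 := by
  obtain ⟨t, ht⟩ := t
  simp only [count]
  clear ht
  induction t with
  | leaf l => rfl
  | node x ch ih => simp [Tree.count, ih]

end ShTree

/-- The disjoint union of indexed sets. -/
abbrev Join (X Y : ℕ+ → Type u) : ℕ+ → Type u := fun m => X m ⊕ Y m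

/-- The indexed set with a single element, of arity `k`. -/
inductive Hole (k : ℕ+) : ℕ+ → Type u
  | box : Hole k k

/-- The `Y`-vertices weigh one and the `X`-vertices weigh zero. -/
def rightWeight (X Y : ℕ+ → Type u) : ∀ k, Join X Y k → ℕ := fun _ => Sum.elim (fun _ => 0) fun _ => 1

/-- The monomial one-hole contexts on `X` of outer arity `n` and inner arity `k`: the tree monomials
on `X` and a hole of arity `k` in which the hole occurs exactly once. -/
def OneHole (X : ℕ+ → Type u) (n k : ℕ+) : Type u :=
  {t : ShTree (Join X (Hole k)) n // t.count (rightWeight X (Hole k)) = 1}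

/-- The monomial two-hole contexts on `X` of outer arity `n` and inner arities `(k, l)`. -/
def TwoHole (X : ℕ+ → Type u) (n k l : ℕ+) : Type u :=
  {t : ShTree (Join X (Join (Hole k) (Hole l))) n //
    t.count (fun _ => Sum.elim (fun _ => 0) (Sum.elim (fun _ => 1) fun _ => 0)) = 1 ∧
    t.count (fun _ => Sum.elim (fun _ => 0) (Sum.elim (fun _ => 0) fun _ => 1)) = 1}

/-- The hole of arity `k` is sent to the tree monomial `w`. -/
def plug {X : ℕ+ → Type u} {k : ℕ+} (w : ShTree X k) : ∀ m, Hole.{u} k m → ShTree X m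
  | _, .box => w

theorem plug_box {X : ℕ+ → Type u} {k : ℕ+} (w : ShTree X k) : plug w k .box = w := rfl

section Contexts

variable {X : ℕ+ → Type u} {n m k l : ℕ+}

/-- The tree monomial `w`, seen as a tree monomial with no occurrence of the other generators. -/
def ShTree.inl {Y : ℕ+ → Type u} (w : ShTree X k) : ShTree (Join X Y) k := w.map (fun _ => Sum.inl)

/-- `Γ[w]` for a tree monomial `w`. -/
def OneHole.fill (Γ : OneHole X n k) (w : ShTree X k) : ShTree X n :=
  Γ.1.subst fun m => Sum.elim (fun x => ShTree.corolla x) (plug w m)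

/-- The trivial one-hole context, reduced to the hole. -/
def OneHole.trivial (X : ℕ+ → Type u) (k : ℕ+) : OneHole X k k :=
  ⟨ShTree.corolla (Sum.inr .box), by rw [ShTree.count_corolla]; rfl⟩

/-- The composite context `Γ[Δ]`. -/
def OneHole.comp (Γ : OneHole X n m) (Δ : OneHole X m k) : OneHole X n k :=
  ⟨Γ.1.subst fun j => Sum.elim (fun x => ShTree.corolla (Sum.inl x)) (plug Δ.1 j), by
    refine (ShTree.count_subst _ _ _).trans (Eq.trans ?_ Γ.2)
    congr 1
    funext j x
    rcases x with x | ⟨⟨⟩⟩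
    · simp [ShTree.count_corolla, rightWeight]
    · simpa [rightWeight, plug_box] using Δ.2⟩

/-- The one-hole context `Θ[w, -]`. -/
def TwoHole.fillLeft (Θ : TwoHole X n k l) (w : ShTree X k) : OneHole X n l :=
  ⟨Θ.1.subst fun j => Sum.elim (fun x => ShTree.corolla (Sum.inl x))
      (Sum.elim (plug w.inl j) fun h => ShTree.corolla (Sum.inr h)), by
    refine (ShTree.count_subst _ _ _).trans (Eq.trans ?_ Θ.2.2)
    congr 1
    funext j x
    rcases x with x | ⟨⟨⟩⟩ | h
    · simp [ShTree.count_corolla, rightWeight]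
    · simp [ShTree.inl, ShTree.map, ShTree.count_subst, ShTree.count_corolla, rightWeight,
        ShTree.count_zero, plug_box]
    · simp [ShTree.count_corolla, rightWeight]⟩

/-- The one-hole context `Θ[-, w]`. -/
def TwoHole.fillRight (Θ : TwoHole X n k l) (w : ShTree X l) : OneHole X n k :=
  ⟨Θ.1.subst fun j => Sum.elim (fun x => ShTree.corolla (Sum.inl x))
      (Sum.elim (fun h => ShTree.corolla (Sum.inr h)) (plug w.inl j)), by
    refine (ShTree.count_subst _ _ _).trans (Eq.trans ?_ Θ.2.1)
    congr 1
    funext j x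
    rcases x with x | h | ⟨⟨⟩⟩
    · simp [ShTree.count_corolla, rightWeight]
    · simp [ShTree.count_corolla, rightWeight]
    · simp [ShTree.inl, ShTree.map, ShTree.count_subst, ShTree.count_corolla, rightWeight,
        ShTree.count_zero, plug_box]⟩

/-- The two-hole context `Γ[Θ]`. -/
def OneHole.compTwo (Γ : OneHole X n m) (Θ : TwoHole X m k l) : TwoHole X n k l :=
  ⟨Γ.1.subst fun j => Sum.elim (fun x => ShTree.corolla (Sum.inl x)) (plug Θ.1 j), by
    constructor
    all_goals
      refine (ShTree.count_subst _ _ _).trans (Eq.trans ?_ Γ.2)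
      congr 1
      funext j x
      rcases x with x | ⟨⟨⟩⟩
      · simp [ShTree.count_corolla, rightWeight]
    · simpa [rightWeight, plug_box] using Θ.2.1
    · simpa [rightWeight, plug_box] using Θ.2.2⟩

theorem ShTree.inl_subst {Y Z : ℕ+ → Type u} (w : ShTree X k) (σ : ∀ j, Join X Y j → ShTree Z j) :
    w.inl.subst σ = w.subst (fun j x => σ j (Sum.inl x)) := by
  simp [ShTree.inl, ShTree.map, ShTree.subst_subst, ShTree.corolla_subst]

theorem OneHole.fill_trivial (w : ShTree X k) : (OneHole.trivial X k).fill w = w := by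
  simp [OneHole.fill, OneHole.trivial, ShTree.corolla_subst, plug_box]

theorem OneHole.fill_comp (Γ : OneHole X n m) (Δ : OneHole X m k) (w : ShTree X k) :
    (Γ.comp Δ).fill w = Γ.fill (Δ.fill w) := by
  simp only [OneHole.fill, OneHole.comp, ShTree.subst_subst]
  congr 1
  funext j x
  rcases x with x | ⟨⟨⟩⟩ <;> simp [ShTree.corolla_subst, plug_box]

theorem OneHole.trivial_comp (Γ : OneHole X n k) : (OneHole.trivial X n).comp Γ = Γ := by
  refine Subtype.ext ?_
  simp [OneHole.comp, OneHole.trivial, ShTree.corolla_subst, plug_box]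

theorem OneHole.comp_assoc {j : ℕ+} (Γ : OneHole X n m) (Δ : OneHole X m k) (Λ : OneHole X k j) :
    (Γ.comp Δ).comp Λ = Γ.comp (Δ.comp Λ) := by
  refine Subtype.ext ?_
  simp only [OneHole.comp, ShTree.subst_subst]
  congr 1
  funext j x
  rcases x with x | ⟨⟨⟩⟩ <;> simp [ShTree.corolla_subst, plug_box]

theorem OneHole.compTwo_fillLeft (Γ : OneHole X n m) (Θ : TwoHole X m k l) (w : ShTree X k) :
    (Γ.compTwo Θ).fillLeft w = Γ.comp (Θ.fillLeft w) := by
  refine Subtype.ext ?_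
  simp only [OneHole.comp, OneHole.compTwo, TwoHole.fillLeft, ShTree.subst_subst]
  congr 1
  funext j x
  rcases x with x | ⟨⟨⟩⟩ <;> simp [ShTree.corolla_subst, plug_box]

theorem OneHole.compTwo_fillRight (Γ : OneHole X n m) (Θ : TwoHole X m k l) (w : ShTree X l) :
    (Γ.compTwo Θ).fillRight w = Γ.comp (Θ.fillRight w) := by
  refine Subtype.ext ?_
  simp only [OneHole.comp, OneHole.compTwo, TwoHole.fillRight, ShTree.subst_subst]
  congr 1
  funext j x
  rcases x with x | ⟨⟨⟩⟩ <;> simp [ShTree.corolla_subst, plug_box]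

theorem TwoHole.fillLeft_fill (Θ : TwoHole X n k l) (w : ShTree X k) (w' : ShTree X l) :
    (Θ.fillLeft w).fill w' = (Θ.fillRight w').fill w := by
  simp only [OneHole.fill, TwoHole.fillLeft, TwoHole.fillRight, ShTree.subst_subst]
  congr 1
  funext j x
  rcases x with x | ⟨⟨⟩⟩ | ⟨⟨⟩⟩ <;>
    simp [ShTree.corolla_subst, plug_box, ShTree.inl_subst, ShTree.subst_corolla]

end Contexts

/-- The terms of arity `n`: linear combinations of tree monomials of arity `n`. They are the
elements of arity `n` of the free shuffle operad on `X`. -/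
abbrev Term (K : Type v) [Field K] (X : ℕ+ → Type u) (n : ℕ+) : Type (max u v) := ShTree X n →₀ K

/-- A reflexive `1`-globular bimodule over the free shuffle operad on `X`. The bimodule structure is
given by the actions `a ↦ Γ[a]` of the monomial one-hole contexts `Γ`. -/
structure GlobularBimodule (K : Type v) [Field K] (X : ℕ+ → Type u) where
  /-- The cells of arity `n`. -/
  Cell : ℕ+ → Type (max u v)
  [addCommGroup : ∀ n, AddCommGroup (Cell n)]
  [module : ∀ n, Module K (Cell n)]
  /-- The map `a ↦ Γ[a]`. -/
  act : ∀ {n k}, OneHole X n k → Cell k →ₗ[K] Cell n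
  /-- The `0`-source. -/
  src : ∀ {n}, Cell n →ₗ[K] Term K X n
  /-- The `0`-target. -/
  tgt : ∀ {n}, Cell n →ₗ[K] Term K X n
  /-- The identity cells. -/
  ident : ∀ {n}, Term K X n →ₗ[K] Cell n
  act_trivial : ∀ {k} (a : Cell k), act (OneHole.trivial X k) a = a
  act_comp : ∀ {n m k} (Γ : OneHole X n m) (Δ : OneHole X m k) (a : Cell k),
    act (Γ.comp Δ) a = act Γ (act Δ a)
  src_act : ∀ {n k} (Γ : OneHole X n k) (a : Cell k),
    src (act Γ a) = Finsupp.mapDomain Γ.fill (src a)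
  tgt_act : ∀ {n k} (Γ : OneHole X n k) (a : Cell k),
    tgt (act Γ a) = Finsupp.mapDomain Γ.fill (tgt a)
  ident_act : ∀ {n k} (Γ : OneHole X n k) (a : Term K X k),
    act Γ (ident a) = ident (Finsupp.mapDomain Γ.fill a)
  src_ident : ∀ {n} (a : Term K X n), src (ident a) = a
  tgt_ident : ∀ {n} (a : Term K X n), tgt (ident a) = a

attribute [instance] GlobularBimodule.addCommGroup GlobularBimodule.module

section Bimodules

variable {K : Type v} [Field K] {X : ℕ+ → Type u} {n m k l : ℕ+}

/-- `Θ[x, y]` for terms `x` and `y`. -/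
noncomputable def TwoHole.fillTerms (Θ : TwoHole X n k l) (x : Term K X k) (y : Term K X l) :
    Term K X n :=
  x.sum fun v c => c • Finsupp.mapDomain (Θ.fillLeft v).fill y

namespace GlobularBimodule

/-- `Θ[a, x]` for a cell `a` and a term `x`. -/
noncomputable def actLeft (A : GlobularBimodule K X) (Θ : TwoHole X n k l) (a : A.Cell k)
    (x : Term K X l) : A.Cell n :=
  x.sum fun v c => c • A.act (Θ.fillRight v) a

/-- `Θ[x, b]` for a term `x` and a cell `b`. -/
noncomputable def actRight (A : GlobularBimodule K X) (Θ : TwoHole X n k l) (x : Term K X k)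
    (b : A.Cell l) : A.Cell n :=
  x.sum fun v c => c • A.act (Θ.fillLeft v) b

/-- The difference of the two sides of the linear exchange relation
`Θ[a, s b] + Θ[t a, b] - Θ[t a, s b] = Θ[s a, b] + Θ[a, t b] - Θ[s a, t b]`. -/
noncomputable def exchangeDefect (A : GlobularBimodule K X) (Θ : TwoHole X n k l) (a : A.Cell k)
    (b : A.Cell l) : A.Cell n :=
  (A.actLeft Θ a (A.src b) + A.actRight Θ (A.tgt a) b
      - A.ident (Θ.fillTerms (A.tgt a) (A.src b))) -
    (A.actRight Θ (A.src a) b + A.actLeft Θ a (A.tgt b)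
      - A.ident (Θ.fillTerms (A.src a) (A.tgt b)))

/-- The subspace spanned by the linear exchange relation. -/
def exchangeRel (A : GlobularBimodule K X) (n : ℕ+) : Submodule K (A.Cell n) :=
  Submodule.span K {z | ∃ (k l : ℕ+) (Θ : TwoHole X n k l) (a : A.Cell k) (b : A.Cell l),
    z = A.exchangeDefect Θ a b}

/-- Morphisms of reflexive `1`-globular bimodules that are the identity on terms. -/
structure Hom (A B : GlobularBimodule K X) where
  map : ∀ {n}, A.Cell n →ₗ[K] B.Cell n
  map_act : ∀ {n k} (Γ : OneHole X n k) (a : A.Cell k), map (A.act Γ a) = B.act Γ (map a)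
  src_map : ∀ {n} (a : A.Cell n), B.src (map a) = A.src a
  tgt_map : ∀ {n} (a : A.Cell n), B.tgt (map a) = A.tgt a
  map_ident : ∀ {n} (x : Term K X n), map (A.ident x) = B.ident x

theorem Hom.map_exchangeDefect {A B : GlobularBimodule K X} (φ : Hom A B) (Θ : TwoHole X n k l)
    (a : A.Cell k) (b : A.Cell l) :
    φ.map (A.exchangeDefect Θ a b) = B.exchangeDefect Θ (φ.map a) (φ.map b) := by
  have hl : ∀ x : Term K X l, φ.map (A.actLeft Θ a x) = B.actLeft Θ (φ.map a) x := fun x => by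
    simp [actLeft, map_finsuppSum, φ.map_act]
  have hr : ∀ x : Term K X k, φ.map (A.actRight Θ x b) = B.actRight Θ x (φ.map b) := fun x => by
    simp [actRight, map_finsuppSum, φ.map_act]
  simp only [exchangeDefect, map_sub, map_add, hl, hr, φ.map_ident, φ.src_map, φ.tgt_map]

theorem mapDomain_fillTerms (Γ : OneHole X n m) (Θ : TwoHole X m k l) (x : Term K X k)
    (y : Term K X l) : Finsupp.mapDomain Γ.fill (Θ.fillTerms x y) =
      (Γ.compTwo Θ).fillTerms x y := by
  have h : ∀ z : Term K X m, Finsupp.mapDomain Γ.fill z = Finsupp.lmapDomain K K Γ.fill z :=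
    fun _ => rfl
  rw [h]
  simp only [TwoHole.fillTerms, map_finsuppSum, map_smul, Finsupp.lmapDomain_apply]
  refine Finsupp.sum_congr fun v _ => ?_
  rw [← Finsupp.mapDomain_comp]
  congr 2
  funext w
  simp [OneHole.compTwo_fillLeft, OneHole.fill_comp]

theorem act_exchangeDefect (A : GlobularBimodule K X) (Γ : OneHole X n m) (Θ : TwoHole X m k l)
    (a : A.Cell k) (b : A.Cell l) :
    A.act Γ (A.exchangeDefect Θ a b) = A.exchangeDefect (Γ.compTwo Θ) a b := by
  have hl : ∀ x : Term K X l, A.act Γ (A.actLeft Θ a x) = A.actLeft (Γ.compTwo Θ) a x :=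
    fun x => by simp [actLeft, map_finsuppSum, OneHole.compTwo_fillRight, A.act_comp]
  have hr : ∀ x : Term K X k, A.act Γ (A.actRight Θ x b) = A.actRight (Γ.compTwo Θ) x b :=
    fun x => by simp [actRight, map_finsuppSum, OneHole.compTwo_fillLeft, A.act_comp]
  simp only [exchangeDefect, map_sub, map_add, hl, hr, A.ident_act, mapDomain_fillTerms]

theorem fillTerms_eq (Θ : TwoHole X n k l) (x : Term K X k) (y : Term K X l) :
    Θ.fillTerms x y = y.sum fun v c => c • Finsupp.mapDomain (Θ.fillRight v).fill x := by
  simp only [TwoHole.fillTerms, Finsupp.mapDomain, Finsupp.smul_sum, Finsupp.smul_single,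
    smul_eq_mul]
  rw [Finsupp.sum_comm]
  simp only [TwoHole.fillLeft_fill, mul_comm]

theorem src_exchangeDefect (A : GlobularBimodule K X) (Θ : TwoHole X n k l) (a : A.Cell k)
    (b : A.Cell l) : A.src (A.exchangeDefect Θ a b) = 0 := by
  have hl : ∀ x : Term K X l, A.src (A.actLeft Θ a x) = Θ.fillTerms (A.src a) x := fun x => by
    simp [actLeft, map_finsuppSum, A.src_act, fillTerms_eq]
  have hr : ∀ x : Term K X k, A.src (A.actRight Θ x b) = Θ.fillTerms x (A.src b) := fun x => by
    simp [actRight, map_finsuppSum, A.src_act, TwoHole.fillTerms]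
  simp only [exchangeDefect, map_sub, map_add, hl, hr, A.src_ident]
  abel

theorem tgt_exchangeDefect (A : GlobularBimodule K X) (Θ : TwoHole X n k l) (a : A.Cell k)
    (b : A.Cell l) : A.tgt (A.exchangeDefect Θ a b) = 0 := by
  have hl : ∀ x : Term K X l, A.tgt (A.actLeft Θ a x) = Θ.fillTerms (A.tgt a) x := fun x => by
    simp [actLeft, map_finsuppSum, A.tgt_act, fillTerms_eq]
  have hr : ∀ x : Term K X k, A.tgt (A.actRight Θ x b) = Θ.fillTerms x (A.tgt b) := fun x => by
    simp [actRight, map_finsuppSum, A.tgt_act, TwoHole.fillTerms]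
  simp only [exchangeDefect, map_sub, map_add, hl, hr, A.tgt_ident]
  abel

theorem exchangeRel_le_of (A : GlobularBimodule K X) {V : Type*} [AddCommGroup V] [Module K V]
    (f : A.Cell n →ₗ[K] V)
    (h : ∀ {k l} (Θ : TwoHole X n k l) a b, f (A.exchangeDefect Θ a b) = 0) :
    A.exchangeRel n ≤ LinearMap.ker f := by
  refine Submodule.span_le.2 ?_
  rintro _ ⟨k, l, Θ, a, b, rfl⟩
  exact h Θ a b

theorem exchangeRel_le_comap (A : GlobularBimodule K X) (Γ : OneHole X n m) :
    A.exchangeRel m ≤ (A.exchangeRel n).comap (A.act Γ) := by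
  refine Submodule.span_le.2 ?_
  rintro _ ⟨k, l, Θ, a, b, rfl⟩
  exact Submodule.subset_span ⟨k, l, Γ.compTwo Θ, a, b, A.act_exchangeDefect Γ Θ a b⟩

/-- The quotient of a reflexive `1`-globular bimodule by the linear exchange relation. -/
noncomputable def exchangeQuotient (A : GlobularBimodule K X) : GlobularBimodule K X where
  Cell n := A.Cell n ⧸ A.exchangeRel n
  act Γ := Submodule.mapQ _ _ (A.act Γ) (A.exchangeRel_le_comap Γ)
  src {n} := (A.exchangeRel n).liftQ A.src (A.exchangeRel_le_of _ A.src_exchangeDefect)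
  tgt {n} := (A.exchangeRel n).liftQ A.tgt (A.exchangeRel_le_of _ A.tgt_exchangeDefect)
  ident {n} := (A.exchangeRel n).mkQ ∘ₗ A.ident
  act_trivial a := by
    obtain ⟨a, rfl⟩ := Submodule.mkQ_surjective _ a
    simp [A.act_trivial]
  act_comp Γ Δ a := by
    obtain ⟨a, rfl⟩ := Submodule.mkQ_surjective _ a
    simp [A.act_comp]
  src_act Γ a := by
    obtain ⟨a, rfl⟩ := Submodule.mkQ_surjective _ a
    simp [A.src_act]
  tgt_act Γ a := by
    obtain ⟨a, rfl⟩ := Submodule.mkQ_surjective _ a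
    simp [A.tgt_act]
  ident_act Γ a := by simp [A.ident_act]
  src_ident a := by simp [A.src_ident]
  tgt_ident a := by simp [A.tgt_ident]

/-- The projection onto the quotient by the linear exchange relation. -/
noncomputable def toExchangeQuotient (A : GlobularBimodule K X) : Hom A A.exchangeQuotient where
  map {n} := (A.exchangeRel n).mkQ
  map_act _ _ := rfl
  src_map _ := rfl
  tgt_map _ := rfl
  map_ident _ := rfl

theorem exchangeDefect_quotient (A : GlobularBimodule K X) (Θ : TwoHole X n k l)
    (a : A.exchangeQuotient.Cell k) (b : A.exchangeQuotient.Cell l) :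
    A.exchangeQuotient.exchangeDefect Θ a b = 0 := by
  obtain ⟨a, rfl⟩ := Submodule.mkQ_surjective _ a
  obtain ⟨b, rfl⟩ := Submodule.mkQ_surjective _ b
  refine (A.toExchangeQuotient.map_exchangeDefect Θ a b).symm.trans ?_
  exact (Submodule.Quotient.mk_eq_zero _).2 (Submodule.subset_span ⟨k, l, Θ, a, b, rfl⟩)

/-- The free shuffle operad on `X`, with `0`-cells only. -/
noncomputable def terms (K : Type v) [Field K] (X : ℕ+ → Type u) : GlobularBimodule K X where
  Cell n := Term K X n
  act Γ := Finsupp.lmapDomain K K Γ.fill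
  src := LinearMap.id
  tgt := LinearMap.id
  ident := LinearMap.id
  act_trivial {k} a := by
    have h : (OneHole.trivial X k).fill = id := funext OneHole.fill_trivial
    rw [Finsupp.lmapDomain_apply, h, Finsupp.mapDomain_id]
  act_comp Γ Δ a := by
    have h : (Γ.comp Δ).fill = Γ.fill ∘ Δ.fill := funext (OneHole.fill_comp Γ Δ)
    simp only [Finsupp.lmapDomain_apply, h, Finsupp.mapDomain_comp]
  src_act _ _ := rfl
  tgt_act _ _ := rfl
  ident_act _ _ := rfl
  src_ident _ := rfl
  tgt_ident _ := rfl

/-- The direct sum of `A` and of the free bimodule on the indexed set `Y`, whose linear basis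
consists of the monomials `Γ[y]`. -/
abbrev FreeCell (A : GlobularBimodule K X) (Y : ℕ+ → Type u) (n : ℕ+) : Type (max u v) :=
  ((Σ k, OneHole X n k × Y k) →₀ K) × A.Cell n

/-- The action of `Γ` on the direct sum: `Δ[y]` is sent to `Γ[Δ][y]`. -/
noncomputable def freeAct (A : GlobularBimodule K X) (Y : ℕ+ → Type u) (Γ : OneHole X n m) :
    A.FreeCell Y m →ₗ[K] A.FreeCell Y n :=
  (Finsupp.lmapDomain K K fun p => ⟨p.1, Γ.comp p.2.1, p.2.2⟩).prodMap (A.act Γ)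

theorem freeAct_trivial (A : GlobularBimodule K X) (Y : ℕ+ → Type u) (a : A.FreeCell Y n) :
    A.freeAct Y (OneHole.trivial X n) a = a := by
  refine Prod.ext ?_ (A.act_trivial _)
  simp only [freeAct, LinearMap.prodMap_apply, Finsupp.lmapDomain_apply, OneHole.trivial_comp]
  exact Finsupp.mapDomain_id

theorem freeAct_comp (A : GlobularBimodule K X) (Y : ℕ+ → Type u) (Γ : OneHole X n m)
    (Δ : OneHole X m k) (a : A.FreeCell Y k) :
    A.freeAct Y (Γ.comp Δ) a = A.freeAct Y Γ (A.freeAct Y Δ a) := by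
  refine Prod.ext ?_ (A.act_comp _ _ _)
  simp only [freeAct, LinearMap.prodMap_apply, Finsupp.lmapDomain_apply, OneHole.comp_assoc]
  exact Finsupp.mapDomain_comp (v := a.1)
    (f := fun p => (⟨p.1, Δ.comp p.2.1, p.2.2⟩ : Σ j, OneHole X m j × Y j))
    (g := fun p => (⟨p.1, Γ.comp p.2.1, p.2.2⟩ : Σ j, OneHole X n j × Y j))

/-- The linear map given by `g` on the monomials and by `h` on `A`. -/
noncomputable def freeExtend (A : GlobularBimodule K X) (Y : ℕ+ → Type u) {V : Type*}
    [AddCommGroup V] [Module K V] (g : ∀ {k}, OneHole X n k → Y k → V) (h : A.Cell n →ₗ[K] V) :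
    A.FreeCell Y n →ₗ[K] V :=
  (Finsupp.linearCombination K fun p : Σ k, OneHole X n k × Y k => g p.2.1 p.2.2).coprod h

theorem freeExtend_freeAct (A : GlobularBimodule K X) (Y : ℕ+ → Type u) {V W : Type*}
    [AddCommGroup V] [Module K V] [AddCommGroup W] [Module K W] (Γ : OneHole X n m)
    (L : V →ₗ[K] W) (g : ∀ {k}, OneHole X m k → Y k → V) (h : A.Cell m →ₗ[K] V)
    (g' : ∀ {k}, OneHole X n k → Y k → W) (h' : A.Cell n →ₗ[K] W)
    (hg : ∀ {k} (Δ : OneHole X m k) y, g' (Γ.comp Δ) y = L (g Δ y))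
    (hh : ∀ a, h' (A.act Γ a) = L (h a)) (a : A.FreeCell Y m) :
    A.freeExtend Y g' h' (A.freeAct Y Γ a) = L (A.freeExtend Y g h a) := by
  obtain ⟨a, b⟩ := a
  simp only [freeExtend, freeAct, LinearMap.prodMap_apply, LinearMap.coprod_apply, map_add, hh,
    add_left_inj, Finsupp.lmapDomain_apply]
  induction a using Finsupp.induction_linear with
  | zero => simp
  | add p q hp hq => simp only [Finsupp.mapDomain_add, map_add, hp, hq]
  | single p c => simp [hg]

theorem map_freeExtend (A : GlobularBimodule K X) (Y : ℕ+ → Type u) {V W : Type*}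
    [AddCommGroup V] [Module K V] [AddCommGroup W] [Module K W] 
    (L : V →ₗ[K] W) (g : ∀ {k}, OneHole X n k → Y k → V) (h : A.Cell n →ₗ[K] V)
    (g' : ∀ {k}, OneHole X n k → Y k → W) (h' : A.Cell n →ₗ[K] W)
    (hg : ∀ {k} (Δ : OneHole X n k) y, L (g Δ y) = g' Δ y)
    (hh : ∀ a, L (h a) = h' a) (a : A.FreeCell Y n) :
    L (A.freeExtend Y g h a) = A.freeExtend Y g' h' a := by
  obtain ⟨a, b⟩ := a
  simp only [freeExtend, LinearMap.coprod_apply, map_add, hh, add_left_inj]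
  induction a using Finsupp.induction_linear with
  | zero => simp
  | add p q hp hq => simp only [map_add, hp, hq]
  | single p c => simp [hg]

theorem freeExtend_inr (A : GlobularBimodule K X) (Y : ℕ+ → Type u) {V : Type*}
    [AddCommGroup V] [Module K V] (g : ∀ {k}, OneHole X n k → Y k → V) (h : A.Cell n →ₗ[K] V)
    (a : A.Cell n) : A.freeExtend Y g h (LinearMap.inr K _ _ a) = h a := by
  simp [freeExtend]

/-- The direct sum of `A` and of the free bimodule on the indexed set `Y`, where the `0`-source and
the `0`-target of `y` are `σ y` and `τ y`. -/
noncomputable def freeSum (A : GlobularBimodule K X) (Y : ℕ+ → Type u)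
    (σ τ : ∀ {k}, Y k → Term K X k) : GlobularBimodule K X where
  Cell n := A.FreeCell Y n
  act Γ := A.freeAct Y Γ
  src {n} := A.freeExtend (V := Term K X n) Y (fun Δ y => Finsupp.mapDomain Δ.fill (σ y)) A.src
  tgt {n} := A.freeExtend (V := Term K X n) Y (fun Δ y => Finsupp.mapDomain Δ.fill (τ y)) A.tgt
  ident {n} := LinearMap.inr K ((Σ k, OneHole X n k × Y k) →₀ K) (A.Cell n) ∘ₗ A.ident
  act_trivial a := A.freeAct_trivial Y a
  act_comp Γ Δ a := A.freeAct_comp Y Γ Δ a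
  src_act Γ a := A.freeExtend_freeAct Y Γ (Finsupp.lmapDomain K K Γ.fill) _ _ _ _
    (fun Δ y => (terms K X).act_comp Γ Δ (σ y)) (A.src_act Γ) a
  tgt_act Γ a := A.freeExtend_freeAct Y Γ (Finsupp.lmapDomain K K Γ.fill) _ _ _ _
    (fun Δ y => (terms K X).act_comp Γ Δ (τ y)) (A.tgt_act Γ) a
  ident_act Γ a := by simp [freeAct, A.ident_act]
  src_ident a := (A.freeExtend_inr Y _ _ _).trans (A.src_ident a)
  tgt_ident a := (A.freeExtend_inr Y _ _ _).trans (A.tgt_ident a)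

theorem map_freeExtend_act (A : GlobularBimodule K X) (Y : ℕ+ → Type u)
    (L : ∀ {n}, A.Cell n →ₗ[K] Term K X n)
    (hL : ∀ {n k} (Γ : OneHole X n k) a, L (A.act Γ a) = Finsupp.mapDomain Γ.fill (L a))
    (σ : ∀ {k}, Y k → Term K X k) (f : ∀ {k}, Y k → A.Cell k)
    (hσ : ∀ {k} (y : Y k), L (f y) = σ y) (a : A.FreeCell Y n) :
    L (A.freeExtend Y (fun Δ y => A.act Δ (f y)) LinearMap.id a) =
      A.freeExtend Y (fun Δ y => Finsupp.mapDomain Δ.fill (σ y)) L a := by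
  refine A.map_freeExtend Y L _ _ _ _ (fun Δ y => ?_) (fun b => rfl) a
  rw [hL, hσ]

/-- The element of the direct sum given by `y`. -/
noncomputable def freeGen (A : GlobularBimodule K X) (Y : ℕ+ → Type u)
    (σ τ : ∀ {k}, Y k → Term K X k) (y : Y k) : (A.freeSum Y σ τ).Cell k :=
  ((Finsupp.single ⟨k, OneHole.trivial X k, y⟩ 1, 0) : A.FreeCell Y k)

/-- The morphism that extends a map `f` from `Y` to `A` and the identity of `A`. -/
noncomputable def freeSumLift (A : GlobularBimodule K X) (Y : ℕ+ → Type u)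
    (σ τ : ∀ {k}, Y k → Term K X k) (f : ∀ {k}, Y k → A.Cell k)
    (hσ : ∀ {k} (y : Y k), A.src (f y) = σ y) (hτ : ∀ {k} (y : Y k), A.tgt (f y) = τ y) :
    Hom (A.freeSum Y σ τ) A where
  map := A.freeExtend Y (fun Δ y => A.act Δ (f y)) LinearMap.id
  map_act Γ a := A.freeExtend_freeAct Y Γ (A.act Γ) _ _ _ _
    (fun Δ y => A.act_comp Γ Δ (f y)) (fun _ => rfl) a
  src_map a := A.map_freeExtend_act Y A.src A.src_act σ f hσ a
  tgt_map a := A.map_freeExtend_act Y A.tgt A.tgt_act τ f hτ a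
  map_ident _ := A.freeExtend_inr Y _ _ _

end GlobularBimodule

end Bimodules

/-- A shuffle `1`-polygraph: indexed sets of `0`-generators and of `1`-generators, where the source
and the target of a `1`-generator are terms on the `0`-generators. -/
structure OnePolygraph (K : Type v) [Field K] where
  gen₀ : ℕ+ → Type u
  gen₁ : ℕ+ → Type u
  src : ∀ {k}, gen₁ k → Term K gen₀ k
  tgt : ∀ {k}, gen₁ k → Term K gen₀ k

namespace OnePolygraph

variable {K : Type v} [Field K] (X : OnePolygraph.{u, v} K) {n k : ℕ+}

/-- The direct sum of the free bimodule on the `1`-generators and of the identities of `0`-cells. -/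
noncomputable def preOne : GlobularBimodule K X.gen₀ :=
  (GlobularBimodule.terms K X.gen₀).freeSum X.gen₁ X.src X.tgt

/-- The `1`-cells of the free shuffle `1`-operad on `X`: the quotient of the direct sum above by the
linear exchange relation. -/
noncomputable def freeOne : GlobularBimodule K X.gen₀ := X.preOne.exchangeQuotient

/-- The `0`-cells of arity `n`. -/
abbrev Cell₀ (n : ℕ+) : Type (max u v) := Term K X.gen₀ n

/-- The `1`-cells of arity `n`. -/
abbrev Cell₁ (n : ℕ+) : Type (max u v) := X.freeOne.Cell n

/-- The identity `1`-cell of a `0`-cell. -/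
noncomputable abbrev one (a : X.Cell₀ n) : X.Cell₁ n := X.freeOne.ident a

/-- The composition `f ⋆₀ g`, meaningful when the target of `f` is the source of `g`. -/
noncomputable def comp (f g : X.Cell₁ n) : X.Cell₁ n := f - X.one (X.freeOne.tgt f) + g

/-- The `1`-cell given by a `1`-generator. -/
noncomputable def generator (α : X.gen₁ k) : X.Cell₁ k :=
  X.preOne.toExchangeQuotient.map
    ((GlobularBimodule.terms K X.gen₀).freeGen X.gen₁ X.src X.tgt α)

/-- The `1`-monomials `Γ[α]`, as formal expressions. -/
abbrev Monomial (n : ℕ+) : Type u := Σ k, OneHole X.gen₀ n k × X.gen₁ k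

variable {X}

/-- The `1`-cell `Γ[α]`. -/
noncomputable def Monomial.cell (p : X.Monomial n) : X.Cell₁ n :=
  X.freeOne.act p.2.1 (X.generator p.2.2)

/-- The source of `Γ[α]`. -/
noncomputable def Monomial.source (p : X.Monomial n) : X.Cell₀ n :=
  Finsupp.mapDomain p.2.1.fill (X.src p.2.2)

/-- The tree monomial on the `0`- and `1`-generators which is given by `Γ[α]`. -/
def Monomial.toTree (p : X.Monomial n) : ShTree (Join X.gen₀ X.gen₁) n :=
  p.2.1.1.subst fun m => Sum.elim (fun x => ShTree.corolla (Sum.inl x))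
    (plug (ShTree.corolla (Sum.inr p.2.2)) m)

variable (X)

/-- The source of every `1`-generator is a nontrivial tree monomial, which does not occur in the
target. -/
def LeftMonomial : Prop :=
  ∀ (k : ℕ+) (α : X.gen₁ k), ∃ u : ShTree X.gen₀ k,
    ¬ u.IsTrivial ∧ X.src α = Finsupp.single u 1 ∧ u ∉ (X.tgt α).support

/-- The strict part `v ≺ u` of the smallest order relation on tree monomials which is stable by
product and such that `v ≺ u` when `u` is the source of a `1`-generator and `v` occurs in its
target. Stability by product amounts to stability under the maps `w ↦ Γ[w]`. -/
inductive Prec : ∀ {n : ℕ+}, ShTree X.gen₀ n → ShTree X.gen₀ n → Prop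
  | rule {k : ℕ+} (α : X.gen₁ k) (u v : ShTree X.gen₀ k) (hu : X.src α = Finsupp.single u 1)
      (hv : v ∈ (X.tgt α).support) : Prec v u
  | context {n k : ℕ+} (Γ : OneHole X.gen₀ n k) (v u : ShTree X.gen₀ k) (h : Prec v u) :
      Prec (Γ.fill v) (Γ.fill u)
  | trans {n : ℕ+} (w v u : ShTree X.gen₀ n) (h₁ : Prec w v) (h₂ : Prec v u) : Prec w u

/-- The relation `≺` is well-founded. -/
def Terminating : Prop := ∀ n : ℕ+, WellFounded (X.Prec (n := n))

/-- The rewriting steps `λ g + 1_c`, where `g` is a `1`-monomial whose source is a tree monomial that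
does not occur in `c`. For a left-monomial polygraph they have size one, since their source and
target are distinct. -/
def IsStep (f : X.Cell₁ n) : Prop :=
  ∃ (p : X.Monomial n) (u : ShTree X.gen₀ n) (r : K) (c : X.Cell₀ n),
    p.source = Finsupp.single u 1 ∧ r ≠ 0 ∧ u ∉ c.support ∧ f = r • p.cell + X.one c

/-- The positive `1`-cells: the (possibly empty) compositions of rewriting steps. -/
inductive IsPositive : X.Cell₁ n → Prop
  | one (a : X.Cell₀ n) : IsPositive (X.one a)
  | comp (f g : X.Cell₁ n) (hf : X.IsStep f) (hg : IsPositive g)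
      (h : X.freeOne.tgt f = X.freeOne.src g) : IsPositive (X.comp f g)

/-- Branchings: pairs of positive `1`-cells with the same source. -/
def IsBranching (f g : X.Cell₁ n) : Prop :=
  X.IsPositive f ∧ X.IsPositive g ∧ X.freeOne.src f = X.freeOne.src g

/-- Local branchings: pairs of rewriting steps with the same source. -/
def IsLocalBranching (f g : X.Cell₁ n) : Prop :=
  X.IsStep f ∧ X.IsStep g ∧ X.freeOne.src f = X.freeOne.src g

/-- Additive branchings `(λ p + μ 1_v + 1_c, λ 1_u + μ q + 1_c)`. -/
def IsAdditive (f g : X.Cell₁ n) : Prop :=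
  ∃ (p q : X.Monomial n) (u v : ShTree X.gen₀ n) (r s : K) (c : X.Cell₀ n),
    p.source = Finsupp.single u 1 ∧ q.source = Finsupp.single v 1 ∧ r ≠ 0 ∧ s ≠ 0 ∧ u ≠ v ∧
    u ∉ c.support ∧ v ∉ c.support ∧
    f = r • p.cell + s • X.one (Finsupp.single v 1) + X.one c ∧
    g = r • X.one (Finsupp.single u 1) + s • q.cell + X.one c

/-- Multiplicative branchings `(λ Θ[p, 1_v] + 1_c, λ Θ[1_u, q] + 1_c)`. -/
def IsMultiplicative (f g : X.Cell₁ n) : Prop :=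
  ∃ (k l : ℕ+) (Θ : TwoHole X.gen₀ n k l) (p : X.Monomial k) (q : X.Monomial l)
    (u : ShTree X.gen₀ k) (v : ShTree X.gen₀ l) (r : K) (c : X.Cell₀ n),
    p.source = Finsupp.single u 1 ∧ q.source = Finsupp.single v 1 ∧ r ≠ 0 ∧
    (Θ.fillLeft u).fill v ∉ c.support ∧
    f = r • X.freeOne.act (Θ.fillRight v) p.cell + X.one c ∧
    g = r • X.freeOne.act (Θ.fillLeft u) q.cell + X.one c

/-- Intersecting branchings: the local branchings that are neither aspherical, nor additive, nor
multiplicative. -/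
def IsIntersecting (f g : X.Cell₁ n) : Prop :=
  X.IsLocalBranching f g ∧ f ≠ g ∧ ¬ X.IsAdditive f g ∧ ¬ X.IsMultiplicative f g

/-- The relation `(f, g) ⊑ (Γ[f] + 1_c, Γ[g] + 1_c)` on branchings. -/
def BranchingLE {m : ℕ+} (f g : X.Cell₁ m) (f' g' : X.Cell₁ n) : Prop :=
  ∃ (Γ : OneHole X.gen₀ n m) (c : X.Cell₀ n),
    f' = X.freeOne.act Γ f + X.one c ∧ g' = X.freeOne.act Γ g + X.one c

/-- Critical branchings: the intersecting branchings that are minimal for `⊑`. -/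
def IsCritical (f g : X.Cell₁ n) : Prop :=
  X.IsIntersecting f g ∧ ∀ (m : ℕ+) (f' g' : X.Cell₁ m),
    X.IsIntersecting f' g' → X.BranchingLE f' g' f g → X.BranchingLE f g f' g'

/-- The data that define a path-lexicographic order: a total order on the `0`- and `1`-generators
for which every `1`-generator is smaller than every `0`-generator, and total orders on the
permutations. -/
structure PathOrder where
  letter : LinearOrder (Σ k, Join X.gen₀ X.gen₁ k)
  perm : ∀ n : ℕ+, LinearOrder (Equiv.Perm (Fin n))
  gen₁_lt_gen₀ : ∀ {k l : ℕ+} (α : X.gen₁ k) (x : X.gen₀ l),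
    letter.lt ⟨k, Sum.inr α⟩ ⟨l, Sum.inl x⟩

variable {X}

/-- The strict path-lexicographic order on `1`-monomials: the sequences of path words are compared
lexicographically, where words are compared lexicographically; in case of equality, the
permutations of the inputs are compared. -/
def PathOrder.Lt (O : X.PathOrder) (p q : X.Monomial n) : Prop :=
  List.Lex (List.Lex O.letter.lt) p.toTree.pathWords q.toTree.pathWords ∨
    (p.toTree.pathWords = q.toTree.pathWords ∧
      (O.perm n).lt p.toTree.inputPerm q.toTree.inputPerm)

/-- The `1`-monomials that have the same source as `p` and lie strictly between `p` and `q`. -/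
def PathOrder.between (O : X.PathOrder) (p q : X.Monomial n) : Set (X.Monomial n) :=
  {r | r.source = p.source ∧ O.Lt p r ∧ O.Lt r q}

/-- Essential branchings: the critical branchings of two `1`-monomials that are consecutive, for the
path-lexicographic order, among the `1`-monomials with the same source. -/
def PathOrder.IsEssential (O : X.PathOrder) (p q : X.Monomial n) : Prop :=
  X.IsCritical p.cell q.cell ∧ O.Lt p q ∧ O.between p q = ∅

end OnePolygraph

/-- A shuffle `2`-polygraph: a `1`-polygraph and an indexed set of `2`-generators, whose source and
target are parallel `1`-cells. -/
structure TwoPolygraph (K : Type v) [Field K] extends OnePolygraph.{u, v} K where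
  gen₂ : ℕ+ → Type u
  src₂ : ∀ {k}, gen₂ k → toOnePolygraph.Cell₁ k
  tgt₂ : ∀ {k}, gen₂ k → toOnePolygraph.Cell₁ k
  src_src₂ : ∀ {k} (A : gen₂ k),
    toOnePolygraph.freeOne.src (src₂ A) = toOnePolygraph.freeOne.src (tgt₂ A)
  tgt_src₂ : ∀ {k} (A : gen₂ k),
    toOnePolygraph.freeOne.tgt (src₂ A) = toOnePolygraph.freeOne.tgt (tgt₂ A)

namespace TwoPolygraph

variable {K : Type v} [Field K] (X : TwoPolygraph.{u, v} K) {n : ℕ+}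

/-- The direct sum of the free bimodule on the `2`-generators and of the identities of `1`-cells. -/
noncomputable def preTwo : GlobularBimodule K X.gen₀ :=
  X.freeOne.freeSum X.gen₂ (fun A => X.freeOne.src (X.src₂ A)) (fun A => X.freeOne.tgt (X.src₂ A))

/-- The `2`-cells of the free shuffle `2`-operad on `X`: the quotient of the direct sum above by the
linear exchange relation. -/
noncomputable def freeTwo : GlobularBimodule K X.gen₀ := X.preTwo.exchangeQuotient

/-- The `2`-cells of arity `n`. -/
abbrev Cell₂ (n : ℕ+) : Type (max u v) := X.freeTwo.Cell n

/-- The source of the `2`-cells, before the quotient. -/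
noncomputable def preSrc : GlobularBimodule.Hom X.preTwo X.freeOne :=
  X.freeOne.freeSumLift X.gen₂ _ _ X.src₂ (fun _ => rfl) (fun _ => rfl)

/-- The target of the `2`-cells, before the quotient. -/
noncomputable def preTgt : GlobularBimodule.Hom X.preTwo X.freeOne :=
  X.freeOne.freeSumLift X.gen₂ _ _ X.tgt₂ (fun A => (X.src_src₂ A).symm)
    (fun A => (X.tgt_src₂ A).symm)

/-- The `1`-source of a `2`-cell. -/
noncomputable def source₁ : X.Cell₂ n →ₗ[K] X.Cell₁ n :=
  (X.preTwo.exchangeRel n).liftQ X.preSrc.map (X.preTwo.exchangeRel_le_of _ fun Θ a b =>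
    (X.preSrc.map_exchangeDefect Θ a b).trans (GlobularBimodule.exchangeDefect_quotient _ Θ _ _))

/-- The `1`-target of a `2`-cell. -/
noncomputable def target₁ : X.Cell₂ n →ₗ[K] X.Cell₁ n :=
  (X.preTwo.exchangeRel n).liftQ X.preTgt.map (X.preTwo.exchangeRel_le_of _ fun Θ a b =>
    (X.preTgt.map_exchangeDefect Θ a b).trans (GlobularBimodule.exchangeDefect_quotient _ Θ _ _))

/-- A pair `(f, g)` of `1`-cells is coherently confluent if there are positive `1`-cells `h` and `k`
and a `2`-cell from `f ⋆₀ h` to `g ⋆₀ k`. -/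
def IsCoherentlyConfluentPair (f g : X.Cell₁ n) : Prop :=
  ∃ h k : X.Cell₁ n, X.IsPositive h ∧ X.IsPositive k ∧
    X.freeOne.tgt f = X.freeOne.src h ∧ X.freeOne.tgt g = X.freeOne.src k ∧
    X.freeOne.tgt h = X.freeOne.tgt k ∧
    ∃ F : X.Cell₂ n, X.source₁ F = X.comp f h ∧ X.target₁ F = X.comp g k

/-- Every branching whose source is the `0`-cell `a` is coherently confluent. -/
def CoherentlyConfluentAt (a : X.Cell₀ n) : Prop :=
  ∀ f g : X.Cell₁ n, X.IsBranching f g → X.freeOne.src f = a → X.IsCoherentlyConfluentPair f g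

/-- The `2`-polygraph is coherently confluent at every `0`-cell. -/
def CoherentlyConfluent : Prop := ∀ (n : ℕ+) (a : X.Cell₀ n), X.CoherentlyConfluentAt a

/-- Every essential branching whose source is the `0`-cell `a` is coherently confluent. -/
def EssentiallyCoherentlyConfluentAt (O : X.PathOrder) (a : X.Cell₀ n) : Prop :=
  ∀ p q : X.Monomial n, O.IsEssential p q → X.freeOne.src p.cell = a →
    X.IsCoherentlyConfluentPair p.cell q.cell

/-- Every essential branching is coherently confluent. -/
def EssentiallyCoherentlyConfluent (O : X.PathOrder) : Prop :=
  ∀ (n : ℕ+) (a : X.Cell₀ n), X.EssentiallyCoherentlyConfluentAt O a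

end TwoPolygraph

end ShufflePoly

/-!
The proof turns coherent confluence into a diamond lemma for linear rewriting with weights.

There is a `2`-cell from `f` to `g` as soon as `f - g` lies in the subspace `S` of the differences
`s F - t F`, since identities may be added to `2`-cells (`sub_mem_boundaries_iff`). The
`displacement` of a `1`-cell `f : a → b` is the pair of `a - b` and of the class of `1_a - f` modulo
`S`. It turns composition into addition, so a positive `1`-cell acts like an ordinary rewriting
path on pairs `(0-cell, weight)` in which the weight records the path modulo `S`, and coherent
confluence is ordinary confluence on such pairs. As in Bergman's diamond lemma
(`eq_zero_of_mem_span_of_irreducible`), this follows from termination if every pair `(p, q)` of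
`1`-monomials with the same source `u` is *resolvable*: `p - q` lies in the space `lower S u` spanned
by `S`, the identities and the monomials with sources below `u` (`exists_comp_sub_comp_mem`).

Resolvability is transitive and stable under contexts (`act_mem_lower`). It holds for multiplicative
pairs by the exchange relation (`exchange_mem_lower`) and for coherently confluent ones
(`IsCoherentlyConfluentPair.sub_mem_lower`). An intersecting pair that is not critical comes from a
pair with a smaller source, through a nontrivial context (`exists_act_of_not_isCritical`), so
induction on the number of vertices of the source leaves the critical pairs. The path-lexicographic
order is total on monomials (`lt_trichotomy`), because the path words of a tree form a prefix code;
hence a critical pair `p ≺ q` is either essential or has a monomial `r` with `p ≺ r ≺ q`, and then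
induction on the finite number of monomials in between, applied to `(p, r)` and `(r, q)`, concludes
(`sub_mem_lower_of_essentiallyCoherentlyConfluent`).
-/

namespace ShufflePoly

/-! ### Path words determine shuffle trees -/

namespace Tree

variable {X : ℕ+ → Type u} {L : Type}

theorem map_fst_paths (t : Tree X L) : t.paths.map Prod.fst = t.leaves := by
  induction t with
  | leaf l => simp [paths, leaves]
  | node x ch ih =>
    simp only [paths, leaves, ← ih, List.map_flatten, List.map_ofFn]
    congr 2
    funext i
    simp

/-- The leaves of a tree with their path words, where each word is preceded by the word `w`. -/
def pathsFrom (w : List (Σ k, X k)) (t : Tree X L) : List (L × List (Σ k, X k)) :=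
  t.paths.map fun p => (p.1, w ++ p.2)

theorem pathsFrom_leaf (w : List (Σ k, X k)) (l : L) :
    (leaf l : Tree X L).pathsFrom w = [(l, w)] := by
  simp [pathsFrom, paths]

theorem pathsFrom_node (w : List (Σ k, X k)) {k : ℕ+} (x : X k) (ch : Fin k → Tree X L) :
    (node x ch).pathsFrom w =
      (List.ofFn fun i => (ch i).pathsFrom (w ++ [⟨k, x⟩])).flatten := by
  simp only [pathsFrom, paths, List.map_flatten, List.map_ofFn]
  congr 2
  funext i
  simp [Function.comp_def]

theorem pathsFrom_ne_nil (w : List (Σ k, X k)) (t : Tree X L) : t.pathsFrom w ≠ [] := by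
  intro h
  apply t.leaves_ne_nil
  rw [← map_fst_paths]
  simp only [pathsFrom, List.map_eq_nil_iff] at h
  simp [h]

theorem prefix_of_mem_pathsFrom_node {w : List (Σ k, X k)} {k : ℕ+} {x : X k}
    {ch : Fin k → Tree X L} {p : L × List (Σ k, X k)} (h : p ∈ (node x ch).pathsFrom w) :
    w ++ [⟨k, x⟩] <+: p.2 := by
  rw [pathsFrom_node] at h
  simp only [List.mem_flatten, List.mem_ofFn] at h
  obtain ⟨_, ⟨i, rfl⟩, h⟩ := h
  simp only [pathsFrom, List.mem_map] at h
  obtain ⟨q, _, rfl⟩ := h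
  exact ⟨q.2, by simp⟩

/-- Concatenations of `k` words of a prefix code can be decoded uniquely. -/
theorem flatten_ofFn_append_cancel {α β : Type*} (g : α → List β) :
    ∀ {k : ℕ} (a b : Fin k → α),
      (∀ i c R R', g (a i) ++ R = g c ++ R' → a i = c ∧ R = R') → ∀ R R',
      (List.ofFn fun i => g (a i)).flatten ++ R = (List.ofFn fun i => g (b i)).flatten ++ R' →
      a = b ∧ R = R'
  | 0, a, b, _, R, R', h => ⟨Subsingleton.elim _ _, by simpa using h⟩
  | k + 1, a, b, H, R, R', h => by
    simp only [List.ofFn_succ, List.flatten_cons, List.append_assoc] at h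
    obtain ⟨h0, h1⟩ := H 0 _ _ _ h
    obtain ⟨h2, h3⟩ := flatten_ofFn_append_cancel g (fun i => a i.succ) (fun i => b i.succ)
      (fun i => H i.succ) R R' h1
    refine ⟨?_, h3⟩
    funext i
    refine Fin.cases h0 (fun j => congrFun h2 j) i

/-- The lists of path words form a prefix code: since the arities can be read off the labels, a
planar tree is recovered by reading its path words from left to right. -/
theorem pathsFrom_append_cancel (t : Tree X L) :
    ∀ (w : List (Σ k, X k)) (t' : Tree X L) (R R' : List (L × List (Σ k, X k))),
      t.pathsFrom w ++ R = t'.pathsFrom w ++ R' → t = t' ∧ R = R' := by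
  induction t with
  | leaf l =>
    intro w t' R R' h
    cases t' with
    | leaf l' => simpa [pathsFrom_leaf] using h
    | node x ch =>
      exfalso
      obtain ⟨p, Q, hp⟩ := List.exists_cons_of_ne_nil (pathsFrom_ne_nil w (node x ch))
      have hm := prefix_of_mem_pathsFrom_node (p := p) (w := w) (x := x) (ch := ch) (by simp [hp])
      rw [hp, pathsFrom_leaf] at h
      simp only [List.cons_append, List.nil_append, List.cons.injEq] at h
      rw [← h.1] at hm
      simpa using hm.length_le
  | @node k x ch ih =>
    intro w t' R R' h
    obtain ⟨p, Q, hp⟩ := List.exists_cons_of_ne_nil (pathsFrom_ne_nil w (node x ch))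
    have hm := prefix_of_mem_pathsFrom_node (p := p) (w := w) (x := x) (ch := ch) (by simp [hp])
    cases t' with
    | leaf l' =>
      exfalso
      rw [hp, pathsFrom_leaf] at h
      simp only [List.cons_append, List.nil_append, List.cons.injEq] at h
      rw [h.1] at hm
      simpa using hm.length_le
    | @node k' x' ch' =>
      obtain ⟨p', Q', hp'⟩ := List.exists_cons_of_ne_nil (pathsFrom_ne_nil w (node x' ch'))
      have hm' := prefix_of_mem_pathsFrom_node (p := p') (w := w) (x := x') (ch := ch')
        (by simp [hp'])
      have hpp : p = p' := by
        rw [hp, hp'] at h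
        simpa using (List.cons.inj h).1
      subst hpp
      have e := List.prefix_of_prefix_length_le hm hm' (by simp)
      have e' := e.eq_of_length (by simp)
      simp only [List.append_cancel_left_eq, List.cons.injEq, and_true] at e'
      cases e'
      rw [pathsFrom_node, pathsFrom_node] at h
      obtain ⟨h1, h2⟩ := flatten_ofFn_append_cancel (pathsFrom (w ++ [⟨k, x⟩])) ch ch'
        (fun i c R R' => ih i _ c R R') R R' h
      exact ⟨by rw [h1], h2⟩

theorem paths_injective : Function.Injective (paths : Tree X L → _) := by
  intro t t' h
  refine (pathsFrom_append_cancel t [] t' [] [] ?_).1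
  simp [pathsFrom, h]

/-- An association list without repeated keys is determined by its keys and its lookup function. -/
theorem eq_map_lookup {α β : Type*} [DecidableEq α] (d : β) :
    ∀ P : List (α × β), (P.map Prod.fst).Nodup →
      P = (P.map Prod.fst).map fun a => (a, (P.lookup a).getD d)
  | [], _ => rfl
  | (a, b) :: P, h => by
    simp only [List.map_cons, List.nodup_cons] at h
    have ih := eq_map_lookup d P h.2
    simp only [List.map_cons, List.lookup_cons, beq_self_eq_true, Option.getD_some,
      List.cons.injEq, true_and, List.map_map]
    nth_rewrite 1 [ih]
    rw [List.map_map]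
    refine List.map_congr_left fun q hq => ?_
    have hne : (q.1 == a) = false := by
      rw [beq_eq_false_iff_ne]
      rintro rfl
      exact h.1 (List.mem_map_of_mem hq)
    simp [hne]

/-! ### Sizes of trees and contexts -/

theorem count_add (w w' : ∀ k, X k → ℕ) (t : Tree X L) :
    t.count (fun k x => w k x + w' k x) = t.count w + t.count w' := by
  induction t with
  | leaf l => rfl
  | node x ch ih =>
    simp only [count, ih, Finset.sum_add_distrib]
    ring

theorem count_mul (c : ℕ) (w : ∀ k, X k → ℕ) (t : Tree X L) :
    t.count (fun k x => c * w k x) = c * t.count w := by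
  induction t with
  | leaf l => rfl
  | node x ch ih => simp only [count, ih, ← Finset.mul_sum, mul_add]

theorem exists_eq_leaf_of_count_eq_zero {w : ∀ k, X k → ℕ} (hw : ∀ k x, w k x ≠ 0)
    {t : Tree X L} (ht : t.count w = 0) : ∃ l, t = leaf l := by
  cases t with
  | leaf l => exact ⟨l, rfl⟩
  | node x ch => exact absurd (Nat.eq_zero_of_add_eq_zero_right ht) (hw _ _)

end Tree

namespace ShTree

variable {X : ℕ+ → Type u} {n : ℕ+}

theorem leaves_eq_ofFn_inputPerm (t : ShTree X n) : t.1.leaves = List.ofFn t.inputPerm := by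
  have h := Fintype.card_congr (t.2.2.1.getEquivOfForallMemList _ t.2.2.2)
  simp only [Fintype.card_fin] at h
  refine List.ext_getElem (by simpa using h) fun i h1 h2 => ?_
  simp [inputPerm]

/-- A shuffle tree monomial is determined by its path words and by its permutation of inputs. -/
theorem eq_of_pathWords_eq {t t' : ShTree X n} (hw : t.pathWords = t'.pathWords)
    (hp : t.inputPerm = t'.inputPerm) : t = t' := by
  refine Subtype.ext (Tree.paths_injective ?_)
  have hl : t.1.leaves = t'.1.leaves := by simp only [leaves_eq_ofFn_inputPerm, hp]
  have hw' : t.pathWord = t'.pathWord := List.ofFn_injective hw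
  rw [Tree.eq_map_lookup [] t.1.paths (by rw [Tree.map_fst_paths]; exact t.2.2.1),
    Tree.eq_map_lookup [] t'.1.paths (by rw [Tree.map_fst_paths]; exact t'.2.2.1),
    Tree.map_fst_paths, Tree.map_fst_paths, hl]
  refine List.map_congr_left fun a _ => ?_
  exact congrArg (Prod.mk a) (congrFun hw' a)

/-- The number of vertices. -/
def size (t : ShTree X n) : ℕ := t.count fun _ _ => 1

end ShTree

namespace OneHole

variable {X : ℕ+ → Type u} {n k : ℕ+}

/-- The number of vertices of a one-hole context, not counting the hole. -/
def size (Γ : OneHole X n k) : ℕ := Γ.1.count fun _ => Sum.elim (fun _ => 1) fun _ => 0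

theorem size_fill (Γ : OneHole X n k) (w : ShTree X k) :
    (Γ.fill w).size = Γ.size + w.size := by
  have h1 : (Γ.fill w).size = Γ.1.count fun j x =>
      (Sum.elim (fun _ => 1) fun _ => 0 : Join X (Hole k) j → ℕ) x
        + w.size * rightWeight X (Hole k) j x := by
    refine (ShTree.count_subst _ _ _).trans ?_
    congr 1
    funext j x
    rcases x with x | ⟨⟨⟩⟩
    · simp [ShTree.count_corolla, rightWeight]
    · simp [rightWeight, plug_box, ShTree.size]
  rw [h1]
  refine (Tree.count_add _ _ _).trans ?_
  rw [Tree.count_mul]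
  have h2 := Γ.2
  rw [ShTree.count] at h2
  rw [h2, mul_one]
  rfl

/-- A context whose only vertex is the hole is trivial: the shuffle condition and the bijectivity of
the leaf labelling leave only one way to label the leaves. -/
theorem eq_trivial_of_size_eq_zero (Γ : OneHole X n k) (h : Γ.size = 0) :
    ∃ e : k = n, e ▸ OneHole.trivial X k = Γ := by
  obtain ⟨⟨t, ht⟩, hc⟩ := Γ
  simp only [size, ShTree.count] at h hc
  cases t with
  | leaf l => simp [Tree.count] at hc
  | @node m x ch =>
    rcases x with x | ⟨⟨⟩⟩
    · simp [Tree.count] at h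
    · simp only [Tree.count, rightWeight, Sum.elim_inr, Nat.add_eq_left,
        Finset.sum_eq_zero_iff, Finset.mem_univ, true_implies] at hc
      simp only [Tree.count, Sum.elim_inr, Nat.zero_add,
        Finset.sum_eq_zero_iff, Finset.mem_univ, true_implies] at h
      have hleaf : ∀ i, ∃ l, ch i = Tree.leaf l := fun i => by
        refine Tree.exists_eq_leaf_of_count_eq_zero (w := fun j x =>
          (Sum.elim (fun _ => 1) fun _ => 0 : Join X (Hole k) j → ℕ) x
            + rightWeight X (Hole k) j x) ?_ ?_
        · rintro j (x | x) <;> simp [rightWeight]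
        · rw [Tree.count_add, h i]
          exact (zero_add _).trans (hc i)
      choose l hl using hleaf
      obtain rfl : ch = fun i => Tree.leaf (l i) := funext hl
      obtain ⟨⟨-, hs⟩, hnd, hall⟩ := ht
      have hmono : StrictMono l := fun i j hij => by
        simpa [Tree.leaves] using hs i j hij
      have hsurj : Function.Surjective l := fun i => by
        simpa [Tree.leaves, eq_comm] using hall i
      have hcard := Fintype.card_congr (Equiv.ofBijective l ⟨hmono.injective, hsurj⟩)
      obtain rfl : k = n := PNat.coe_injective (by simpa using hcard)
      obtain rfl : l = id := by
        have := Subsingleton.elim (StrictMono.orderIsoOfSurjective l hmono hsurj) (OrderIso.refl _)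
        exact congrArg (fun f : _ ≃o _ => (f : _ → _)) this
      exact ⟨rfl, rfl⟩

end OneHole

/-! ### Totality of the path-lexicographic order -/

/-- The tree on two kinds of vertices that is obtained by labelling the holes of a tree by `α`. -/
def Tree.label {X Y : ℕ+ → Type u} {L : Type} {k : ℕ+} (α : Y k) :
    Tree (Join X (Hole k)) L → Tree (Join X Y) L
  | .leaf l => .leaf l
  | .node (Sum.inl x) ch => .node (Sum.inl x) fun i => (ch i).label α
  | .node (Sum.inr .box) ch => .node (Sum.inr α) fun i => (ch i).label α

theorem Tree.label_injective {X Y : ℕ+ → Type u} {L : Type} {k : ℕ+} (α : Y k) :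
    Function.Injective (label α : Tree (Join X (Hole k)) L → Tree (Join X Y) L) := by
  intro t
  induction t with
  | leaf l =>
    intro t' h
    rcases t' with l' | ⟨x' | ⟨⟨⟩⟩, ch'⟩ <;> simp only [label, Tree.leaf.injEq, reduceCtorEq] at h
    rw [h]
  | node x ch ih =>
    intro t' h
    rcases x with x | ⟨⟨⟩⟩ <;> rcases t' with l' | ⟨x' | ⟨⟨⟩⟩, ch'⟩ <;>
      simp only [label, Tree.node.injEq, reduceCtorEq] at h
    · obtain ⟨rfl, h1, h2⟩ := h
      cases h1
      exact congrArg _ (funext fun i => ih i (congrFun (eq_of_heq h2) i))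
    · obtain ⟨rfl, h1, -⟩ := h
      cases h1
    · obtain ⟨rfl, h1, -⟩ := h
      cases h1
    · exact congrArg _ (funext fun i => ih i (congrFun (eq_of_heq h.2.2) i))

/-- A label of a hole that occurs can be read off the labelled tree. -/
theorem Tree.eq_of_label_eq_label {X Y : ℕ+ → Type u} {L : Type} {k k' : ℕ+} (α : Y k) (α' : Y k')
    (t : Tree (Join X (Hole k)) L) (t' : Tree (Join X (Hole k')) L)
    (h : t.label α = t'.label α') (ht : t.count (rightWeight X (Hole k)) ≠ 0) :
    (⟨k, α⟩ : Σ k, Y k) = ⟨k', α'⟩ := by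
  induction t generalizing t' with
  | leaf l => simp [count] at ht
  | node x ch ih =>
    rcases x with x | ⟨⟨⟩⟩ <;> rcases t' with l' | ⟨x' | ⟨⟨⟩⟩, ch'⟩ <;>
      simp only [label, Tree.node.injEq, reduceCtorEq] at h
    · obtain ⟨rfl, -, h2⟩ := h
      obtain ⟨i, -, hi⟩ : ∃ i ∈ Finset.univ, (ch i).count (rightWeight X (Hole k)) ≠ 0 := by
        refine Finset.exists_ne_zero_of_sum_ne_zero ?_
        simpa only [count, rightWeight, Sum.elim_inl, zero_add] using ht
      exact ih i (ch' i) (congrFun (eq_of_heq h2) i) hi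
    · obtain ⟨rfl, h1, -⟩ := h
      cases h1
    · obtain ⟨rfl, h1, -⟩ := h
      cases h1
    · obtain ⟨rfl, h1, -⟩ := h
      cases h1
      rfl

namespace OnePolygraph

variable {K : Type v} [Field K] {X : OnePolygraph.{u, v} K} {n : ℕ+}

theorem Monomial.toTree_val (p : X.Monomial n) : p.toTree.1 = p.2.1.1.1.label p.2.2 := by
  obtain ⟨k, ⟨⟨t, ht⟩, hc⟩, α⟩ := p
  simp only [toTree, ShTree.subst]
  clear ht hc
  induction t with
  | leaf l => rfl
  | node x ch ih => rcases x with x | ⟨⟨⟩⟩ <;> exact congrArg _ (funext ih)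

/-- The context and the `1`-generator can be recovered from the tree monomial `Γ[α]`. -/
theorem Monomial.toTree_injective : Function.Injective (toTree : X.Monomial n → _) := by
  rintro ⟨k, Γ, α⟩ ⟨k', Γ', α'⟩ h
  have h := congrArg Subtype.val h
  rw [toTree_val, toTree_val] at h
  cases Tree.eq_of_label_eq_label α α' _ _ h (by
    have := Γ.2
    rw [ShTree.count] at this
    simp [this])
  have h' := Subtype.ext (Subtype.ext (Tree.label_injective α h))
  simp only at h'
  rw [h']

namespace PathOrder

variable (O : X.PathOrder)

theorem lt_trichotomy (p q : X.Monomial n) : O.Lt p q ∨ p = q ∨ O.Lt q p := by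
  let := O.letter
  let := O.perm n
  rcases trichotomous_of (List.Lex (List.Lex O.letter.lt)) p.toTree.pathWords q.toTree.pathWords
    with h | h | h
  · exact Or.inl (Or.inl h)
  · rcases _root_.lt_trichotomy p.toTree.inputPerm q.toTree.inputPerm with h' | h' | h'
    · exact Or.inl (Or.inr ⟨h, h'⟩)
    · exact Or.inr (Or.inl (Monomial.toTree_injective (ShTree.eq_of_pathWords_eq h h')))
    · exact Or.inr (Or.inr (Or.inr ⟨h.symm, h'⟩))
  · exact Or.inr (Or.inr (Or.inl h))

theorem lt_irrefl (p : X.Monomial n) : ¬ O.Lt p p := by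
  let := O.letter
  let := O.perm n
  rintro (h | ⟨-, h⟩)
  · exact irrefl_of (List.Lex (List.Lex O.letter.lt)) _ h
  · exact _root_.lt_irrefl _ h

theorem lt_trans {p q r : X.Monomial n} (h₁ : O.Lt p q) (h₂ : O.Lt q r) : O.Lt p r := by
  let := O.letter
  let := O.perm n
  have hw : ∀ {a b c : List (Σ k, Join X.gen₀ X.gen₁ k)}, List.Lex O.letter.lt a b →
      List.Lex O.letter.lt b c → List.Lex O.letter.lt a c :=
    fun h h' => List.lex_trans (fun h h' => _root_.lt_trans h h') h h'
  rcases h₁ with h₁ | ⟨e₁, h₁⟩ <;> rcases h₂ with h₂ | ⟨e₂, h₂⟩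
  · exact Or.inl (List.lex_trans hw h₁ h₂)
  · exact Or.inl (e₂ ▸ h₁)
  · exact Or.inl (e₁ ▸ h₂)
  · exact Or.inr ⟨e₁.trans e₂, _root_.lt_trans h₁ h₂⟩

end PathOrder

end OnePolygraph

end ShufflePoly

/-! ### A diamond lemma with weights -/

/-- A diamond lemma with weights in a module `W`. Each rule `p` rewrites the element `s p` into a
combination of smaller ones while adding an element of `W`, which is never rewritten; `d p` is the
difference of the two sides. If any two rules with the same left-hand side differ by a combination
of rules with smaller left-hand sides, then a combination of rules whose first component is
irreducible vanishes. The reason is that the normal form computed with one chosen rule for every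
reducible element is then invariant under all rules. -/
theorem eq_zero_of_mem_span_of_irreducible {K M W P : Type*} [Field K] [AddCommGroup W] [Module K W]
    (r : M → M → Prop) (hr : WellFounded r) (s : P → M) (d : P → (M →₀ K) × W)
    (hd : ∀ p, ∀ v ∈ (Finsupp.single (s p) 1 - (d p).1).support, r v (s p))
    (hres : ∀ p q, s p = s q → d p - d q ∈ Submodule.span K (d '' {p' | r (s p') (s p)}))
    {x : (M →₀ K) × W} (hx : x ∈ Submodule.span K (Set.range d))
    (hirr : ∀ p, s p ∉ x.1.support) : x = 0 := by
  classical
  -- `nf u` is the normal form of `u`, computed by applying to each reducible element a chosen rule;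
  -- the junk value `0` is never used, since a rule only produces smaller elements
  let step (u : M) (rec : ∀ v, r v u → (M →₀ K) × W) : (M →₀ K) × W :=
    if h : ∃ p, s p = u then
      ((Finsupp.single u 1 - (d h.choose).1).sum fun v c => c • if hv : r v u then rec v hv else 0)
        - (0, (d h.choose).2)
    else (Finsupp.single u 1, 0)
  let nf : M → (M →₀ K) × W := hr.fix step
  let N : (M →₀ K) × W →ₗ[K] (M →₀ K) × W :=
    (Finsupp.linearCombination K nf).coprod (LinearMap.inr K (M →₀ K) W)
  have hnf : ∀ u, nf u = step u fun v _ => nf v := fun u => hr.fix_eq step u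
  have hN : ∀ a w, N (a, w) = (a.sum fun v c => c • nf v) + (0, w) := fun a w => by
    simp [N, Finsupp.linearCombination_apply]
  -- by construction, `N` kills one rule for every reducible element
  have hchoice : ∀ (p : P), ∃ q, s q = s p ∧ N (d q) = 0 := by
    intro p
    have h : ∃ q, s q = s p := ⟨p, rfl⟩
    refine ⟨h.choose, h.choose_spec, ?_⟩
    have h1 := hnf (s p)
    simp only [step, dif_pos h] at h1
    have h2 : ((Finsupp.single (s p) 1 - (d h.choose).1).sum fun v c =>
        c • if _ : r v (s p) then nf v else 0) =
        (Finsupp.single (s p) 1 - (d h.choose).1).sum fun v c => c • nf v := by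
      refine Finsupp.sum_congr fun v hv => ?_
      rw [dif_pos]
      have := hd h.choose
      rw [h.choose_spec] at this
      exact this v hv
    rw [h2, Finsupp.sum_sub_index (h := fun v c => c • nf v) (fun v b c => sub_smul b c (nf v)),
      Finsupp.sum_single_index (h := fun v c => c • nf v) (zero_smul K (nf (s p))), one_smul] at h1
    have h3 := hN (d h.choose).1 (d h.choose).2
    rw [Prod.mk.eta] at h3
    rw [h3]
    rw [sub_sub, eq_comm, sub_eq_self] at h1
    exact h1
  have hzero : ∀ u, ∀ p, s p = u → N (d p) = 0 := by
    intro u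
    induction u using hr.induction with
    | _ u ih =>
    rintro p rfl
    obtain ⟨q, hq, hq0⟩ := hchoice p
    have hle : Submodule.span K (d '' {p' | r (s p') (s p)}) ≤ LinearMap.ker N := by
      rw [Submodule.span_le]
      rintro _ ⟨p', hp', rfl⟩
      exact ih _ hp' p' rfl
    have := hle (hres p q hq.symm)
    rwa [LinearMap.mem_ker, map_sub, hq0, sub_zero] at this
  have hker : Submodule.span K (Set.range d) ≤ LinearMap.ker N := by
    rw [Submodule.span_le]
    rintro _ ⟨p, rfl⟩
    exact hzero _ p rfl
  have hfix : N x = x := by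
    obtain ⟨a, w⟩ := x
    rw [hN]
    have : (a.sum fun v c => c • nf v) =
        a.sum fun v c => ((Finsupp.single v c, 0) : (M →₀ K) × W) := by
      refine Finsupp.sum_congr fun v hv => ?_
      have hv' : ¬ ∃ p, s p = v := by
        rintro ⟨p, rfl⟩
        exact hirr p hv
      rw [hnf]
      simp only [step, dif_neg hv', Prod.smul_mk, Finsupp.smul_single, smul_eq_mul, mul_one,
        smul_zero]
    rw [this]
    have h2 : (a.sum fun v c => ((Finsupp.single v c, 0) : (M →₀ K) × W)) = (a, 0) := by
      have := map_finsuppSum (LinearMap.inl K (M →₀ K) W) a Finsupp.single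
      rw [Finsupp.sum_single] at this
      exact this.symm
    rw [h2]
    simp
  rw [← hfix]
  exact hker hx

namespace ShufflePoly

/-! ### Cells and monomials -/

theorem GlobularBimodule.freeExtend_single {K : Type v} [Field K] {X : ℕ+ → Type u} {n k : ℕ+}
    (A : GlobularBimodule K X) (Y : ℕ+ → Type u) {V : Type*} [AddCommGroup V] [Module K V]
    (g : ∀ {k}, OneHole X n k → Y k → V) (h : A.Cell n →ₗ[K] V) (Γ : OneHole X n k) (y : Y k) :
    A.freeExtend Y g h (Finsupp.single ⟨k, Γ, y⟩ 1, 0) = g Γ y := by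
  simp [freeExtend]

namespace OnePolygraph

variable {K : Type v} [Field K] {X : OnePolygraph.{u, v} K} {n m k l : ℕ+}

theorem src_generator (α : X.gen₁ k) : X.freeOne.src (X.generator α) = X.src α := by
  have h : (OneHole.trivial X.gen₀ k).fill = id := funext OneHole.fill_trivial
  have e := (GlobularBimodule.terms K X.gen₀).freeExtend_single (V := Term K X.gen₀ k) X.gen₁
    (fun Δ y => Finsupp.mapDomain Δ.fill (X.src y)) LinearMap.id (OneHole.trivial X.gen₀ k) α
  rw [h, Finsupp.mapDomain_id] at e
  exact (X.preOne.toExchangeQuotient.src_map _).trans e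

theorem tgt_generator (α : X.gen₁ k) : X.freeOne.tgt (X.generator α) = X.tgt α := by
  have h : (OneHole.trivial X.gen₀ k).fill = id := funext OneHole.fill_trivial
  have e := (GlobularBimodule.terms K X.gen₀).freeExtend_single (V := Term K X.gen₀ k) X.gen₁
    (fun Δ y => Finsupp.mapDomain Δ.fill (X.tgt y)) LinearMap.id (OneHole.trivial X.gen₀ k) α
  rw [h, Finsupp.mapDomain_id] at e
  exact (X.preOne.toExchangeQuotient.tgt_map _).trans e

theorem src_one (a : X.Cell₀ n) : X.freeOne.src (X.one a) = a := X.freeOne.src_ident a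

theorem tgt_one (a : X.Cell₀ n) : X.freeOne.tgt (X.one a) = a := X.freeOne.tgt_ident a

theorem src_comp {f g : X.Cell₁ n} (h : X.freeOne.tgt f = X.freeOne.src g) :
    X.freeOne.src (X.comp f g) = X.freeOne.src f := by
  rw [comp, map_add, map_sub, src_one, ← h, sub_add_cancel]

theorem tgt_comp (f g : X.Cell₁ n) : X.freeOne.tgt (X.comp f g) = X.freeOne.tgt g := by
  rw [comp, map_add, map_sub, tgt_one, sub_self, zero_add]

namespace Monomial

/-- The `1`-monomial `Γ[p]`. -/
def act (Γ : OneHole X.gen₀ n m) (p : X.Monomial m) : X.Monomial n := ⟨p.1, Γ.comp p.2.1, p.2.2⟩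

theorem cell_act (Γ : OneHole X.gen₀ n m) (p : X.Monomial m) :
    (p.act Γ).cell = X.freeOne.act Γ p.cell :=
  X.freeOne.act_comp _ _ _

theorem src_cell (p : X.Monomial n) : X.freeOne.src p.cell = p.source := by
  rw [cell, X.freeOne.src_act, src_generator, source]

theorem tgt_cell (p : X.Monomial n) :
    X.freeOne.tgt p.cell = Finsupp.mapDomain p.2.1.fill (X.tgt p.2.2) := by
  rw [cell, X.freeOne.tgt_act, tgt_generator]

theorem source_act (Γ : OneHole X.gen₀ n m) {p : X.Monomial m} {u : ShTree X.gen₀ m}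
    (hu : p.source = Finsupp.single u 1) : (p.act Γ).source = Finsupp.single (Γ.fill u) 1 := by
  rw [← src_cell, cell_act, X.freeOne.src_act, src_cell, hu, Finsupp.mapDomain_single]

theorem exists_source_eq_single (hL : X.LeftMonomial) (p : X.Monomial n) :
    ∃ u, p.source = Finsupp.single u 1 := by
  obtain ⟨u, -, hu, -⟩ := hL p.1 p.2.2
  exact ⟨p.2.1.fill u, by rw [source, hu, Finsupp.mapDomain_single]⟩

theorem prec_of_mem_support_tgt (hL : X.LeftMonomial) {p : X.Monomial n} {u v : ShTree X.gen₀ n}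
    (hu : p.source = Finsupp.single u 1) (hv : v ∈ (X.freeOne.tgt p.cell).support) :
    X.Prec v u := by
  classical
  obtain ⟨w, -, hw, -⟩ := hL p.1 p.2.2
  rw [source, hw, Finsupp.mapDomain_single] at hu
  obtain rfl := Finsupp.single_left_injective one_ne_zero hu
  rw [tgt_cell] at hv
  obtain ⟨v', hv', rfl⟩ := Finset.mem_image.1 (Finsupp.mapDomain_support hv)
  exact Prec.context _ _ _ (Prec.rule _ _ _ hw hv')

end Monomial

theorem Terminating.irrefl (hT : X.Terminating) (u : ShTree X.gen₀ n) : ¬ X.Prec u u :=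
  fun h => (hT n).irrefl.irrefl u h

theorem Monomial.tgt_apply_source (hT : X.Terminating) (hL : X.LeftMonomial) {p : X.Monomial n}
    {u : ShTree X.gen₀ n} (hu : p.source = Finsupp.single u 1) : X.freeOne.tgt p.cell u = 0 := by
  by_contra h
  exact hT.irrefl u (prec_of_mem_support_tgt hL hu (Finsupp.mem_support_iff.2 h))

/-! ### Resolvable pairs of monomials -/

/-- For a family `S` of subspaces (which will be the differences `s F - t F` for `2`-cells `F`): the
`1`-cells that are, modulo `S` and modulo identities, linear combinations of `1`-monomials whose
sources are smaller than `u`. -/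
noncomputable def lower (S : ∀ n, Submodule K (X.Cell₁ n)) (u : ShTree X.gen₀ n) :
    Submodule K (X.Cell₁ n) :=
  S n ⊔ LinearMap.range X.freeOne.ident ⊔
    Submodule.span K {x | ∃ (p : X.Monomial n) (v : ShTree X.gen₀ n),
      p.source = Finsupp.single v 1 ∧ X.Prec v u ∧ p.cell = x}

variable {S : ∀ n, Submodule K (X.Cell₁ n)}

theorem le_lower (u : ShTree X.gen₀ n) : S n ≤ lower S u :=
  le_sup_left.trans le_sup_left

theorem one_mem_lower (u : ShTree X.gen₀ n) (a : X.Cell₀ n) : X.one a ∈ lower S u :=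
  (le_sup_right.trans le_sup_left : LinearMap.range X.freeOne.ident ≤ lower S u) ⟨a, rfl⟩

theorem cell_mem_lower {p : X.Monomial n} {u v : ShTree X.gen₀ n}
    (hp : p.source = Finsupp.single v 1) (h : X.Prec v u) : p.cell ∈ lower S u :=
  (le_sup_right : _ ≤ lower S u) (Submodule.subset_span ⟨p, v, hp, h, rfl⟩)

theorem act_mem_lower (hS : ∀ {n m} (Γ : OneHole X.gen₀ n m), S m ≤ (S n).comap (X.freeOne.act Γ))
    (Γ : OneHole X.gen₀ n m) {u : ShTree X.gen₀ m} {x : X.Cell₁ m} (hx : x ∈ lower S u) :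
    X.freeOne.act Γ x ∈ lower S (Γ.fill u) := by
  have h : lower S u ≤ (lower S (Γ.fill u)).comap (X.freeOne.act Γ) := by
    refine sup_le (sup_le ((hS Γ).trans (Submodule.comap_mono (le_lower _))) ?_)
      (Submodule.span_le.2 ?_)
    · rintro _ ⟨a, rfl⟩
      rw [Submodule.mem_comap, X.freeOne.ident_act]
      exact one_mem_lower _ _
    · rintro _ ⟨p, v, hp, hv, rfl⟩
      rw [SetLike.mem_coe, Submodule.mem_comap, ← Monomial.cell_act]
      exact cell_mem_lower (Monomial.source_act Γ hp) (Prec.context Γ _ _ hv)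
  exact h hx

theorem mem_lower_of_isPositive (hL : X.LeftMonomial) {u : ShTree X.gen₀ n} {h : X.Cell₁ n}
    (hh : X.IsPositive h) (hu : ∀ v ∈ (X.freeOne.src h).support, X.Prec v u) : h ∈ lower S u := by
  classical
  induction hh with
  | one a => exact one_mem_lower u a
  | comp f g hf hg hfg ih =>
    rw [src_comp hfg] at hu
    obtain ⟨p, v, r, c, hp, hr, hvc, rfl⟩ := hf
    simp only [map_add, map_smul, Monomial.src_cell, hp, src_one] at hu
    have hv : X.Prec v u := by
      refine hu v ?_
      rw [Finsupp.mem_support_iff]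
      simp [Finsupp.notMem_support_iff.1 hvc, hr]
    have hc : ∀ w ∈ c.support, X.Prec w u := fun w hw => by
      refine hu w ?_
      have hne : v ≠ w := fun e => hvc (e ▸ hw)
      rw [Finsupp.mem_support_iff] at hw ⊢
      simpa [Finsupp.single_apply, hne] using hw
    refine add_mem (sub_mem (add_mem (Submodule.smul_mem _ _ (cell_mem_lower hp hv))
      (one_mem_lower _ _)) (one_mem_lower _ _)) (ih fun w hw => ?_)
    rw [← hfg, map_add, map_smul, tgt_one] at hw
    rcases Finset.mem_union.1 (Finsupp.support_add hw) with hw | hw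
    · exact Prec.trans _ _ _
        (Monomial.prec_of_mem_support_tgt hL hp (Finsupp.support_smul hw)) hv
    · exact hc w hw

/-- The exchange relation resolves multiplicative pairs: it expresses the difference through
monomials in which one of the two sources has already been replaced by its target. -/
theorem exchange_mem_lower (hL : X.LeftMonomial) (Θ : TwoHole X.gen₀ n k l) {p : X.Monomial k}
    {q : X.Monomial l} {u : ShTree X.gen₀ k} {v : ShTree X.gen₀ l}
    (hp : p.source = Finsupp.single u 1) (hq : q.source = Finsupp.single v 1) :
    X.freeOne.act (Θ.fillRight v) p.cell - X.freeOne.act (Θ.fillLeft u) q.cell ∈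
      lower S ((Θ.fillLeft u).fill v) := by
  have h := X.preOne.exchangeDefect_quotient Θ p.cell q.cell
  change X.freeOne.exchangeDefect Θ p.cell q.cell = 0 at h
  have hl : X.freeOne.actLeft Θ p.cell (X.freeOne.tgt q.cell) ∈
      lower S ((Θ.fillLeft u).fill v) := by
    refine sum_mem fun w hw => Submodule.smul_mem _ _ ?_
    rw [← Monomial.cell_act]
    refine cell_mem_lower (Monomial.source_act _ hp) ?_
    rw [← TwoHole.fillLeft_fill]
    exact Prec.context _ _ _ (Monomial.prec_of_mem_support_tgt hL hq hw)
  have hr : X.freeOne.actRight Θ (X.freeOne.tgt p.cell) q.cell ∈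
      lower S ((Θ.fillLeft u).fill v) := by
    refine sum_mem fun w hw => Submodule.smul_mem _ _ ?_
    rw [← Monomial.cell_act]
    refine cell_mem_lower (Monomial.source_act _ hq) ?_
    rw [TwoHole.fillLeft_fill, TwoHole.fillLeft_fill]
    exact Prec.context _ _ _ (Monomial.prec_of_mem_support_tgt hL hp hw)
  simp only [GlobularBimodule.exchangeDefect, Monomial.src_cell, hp, hq] at h
  have e1 : X.freeOne.actLeft Θ p.cell (Finsupp.single v 1) =
      X.freeOne.act (Θ.fillRight v) p.cell := by
    simp [GlobularBimodule.actLeft]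
  have e2 : X.freeOne.actRight Θ (Finsupp.single u 1) q.cell =
      X.freeOne.act (Θ.fillLeft u) q.cell := by
    simp [GlobularBimodule.actRight]
  rw [e1, e2] at h
  have e : X.freeOne.act (Θ.fillRight v) p.cell - X.freeOne.act (Θ.fillLeft u) q.cell =
      X.freeOne.actLeft Θ p.cell (X.freeOne.tgt q.cell)
        - X.freeOne.actRight Θ (X.freeOne.tgt p.cell) q.cell
        + X.one (Θ.fillTerms (X.freeOne.tgt p.cell) (Finsupp.single v 1))
        - X.one (Θ.fillTerms (Finsupp.single u 1) (X.freeOne.tgt q.cell)) := by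
    rw [← sub_eq_zero, ← h]
    simp only [one]
    abel
  rw [e]
  exact sub_mem (add_mem (sub_mem hl hr) (one_mem_lower _ _)) (one_mem_lower _ _)

/-! ### Branchings of two monomials -/

theorem Monomial.isStep (p : X.Monomial n) {u : ShTree X.gen₀ n}
    (hp : p.source = Finsupp.single u 1) (c : X.Cell₀ n) (hc : u ∉ c.support) :
    X.IsStep (p.cell + X.one c) :=
  ⟨p, u, 1, c, hp, one_ne_zero, hc, by rw [one_smul]⟩

theorem isLocalBranching_cell {p q : X.Monomial n} {u : ShTree X.gen₀ n}
    (hp : p.source = Finsupp.single u 1) (hq : q.source = Finsupp.single u 1) :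
    X.IsLocalBranching p.cell q.cell := by
  refine ⟨?_, ?_, by rw [Monomial.src_cell, Monomial.src_cell, hp, hq]⟩
  · simpa using p.isStep hp 0 (by simp)
  · simpa using q.isStep hq 0 (by simp)

theorem not_isAdditive_cell {p q : X.Monomial n} {w : ShTree X.gen₀ n}
    (hp : p.source = Finsupp.single w 1) : ¬ X.IsAdditive p.cell q.cell := by
  classical
  rintro ⟨p', q', u, v, r, s, c, hp', -, hr, hs, huv, hu, hv, h, -⟩
  have h1 := congrArg X.freeOne.src h
  simp only [map_add, map_smul, Monomial.src_cell, hp, hp', src_one] at h1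
  have hu1 := DFunLike.congr_fun h1 u
  have hv1 := DFunLike.congr_fun h1 v
  simp only [Finsupp.notMem_support_iff] at hu hv
  simp [Finsupp.single_apply, hu, hv, huv, huv.symm] at hu1 hv1
  by_cases e : w = u
  · subst e
    simp [huv] at hv1
    exact hs hv1.symm
  · simp [e] at hu1
    exact hr hu1.symm

theorem sub_mem_lower_of_isMultiplicative (hL : X.LeftMonomial) {p q : X.Monomial n}
    {w : ShTree X.gen₀ n} (hp : p.source = Finsupp.single w 1)
    (h : X.IsMultiplicative p.cell q.cell) : p.cell - q.cell ∈ lower S w := by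
  classical
  obtain ⟨k, l, Θ, p', q', u, v, r, c, hp', hq', hr, hc, h1, h2⟩ := h
  have h3 := congrArg X.freeOne.src h1
  simp only [map_add, map_smul, Monomial.src_cell, hp, hp', src_one, X.freeOne.src_act,
    Finsupp.mapDomain_single, ← TwoHole.fillLeft_fill] at h3
  have h4 := DFunLike.congr_fun h3 ((Θ.fillLeft u).fill v)
  simp only [Finsupp.notMem_support_iff] at hc
  simp [Finsupp.single_apply, hc] at h4
  have hw : w = (Θ.fillLeft u).fill v := by
    by_contra e
    simp [e] at h4
    exact hr h4.symm
  subst hw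
  have e : p.cell - q.cell = r • (X.freeOne.act (Θ.fillRight v) p'.cell -
      X.freeOne.act (Θ.fillLeft u) q'.cell) := by
    rw [h1, h2, smul_sub]
    abel
  rw [e]
  exact Submodule.smul_mem _ _ (exchange_mem_lower hL Θ hp' hq')

/-- A monomial `p` can be written as `r q + 1_c` only in the trivial way: the source of `p` and that
of `q` are each the unique maximal tree monomial in the difference between source and target of
that `1`-cell, so they agree. This holds for an arbitrary `c`, possibly containing the source of
`q`. -/
theorem Monomial.eq_of_cell_eq (hT : X.Terminating) (hL : X.LeftMonomial) {p : X.Monomial n}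
    {q : X.Monomial n} {u v : ShTree X.gen₀ n} {r : K} {c : X.Cell₀ n} (hr : r ≠ 0)
    (hp : p.source = Finsupp.single u 1) (hq : q.source = Finsupp.single v 1)
    (h : p.cell = r • q.cell + X.one c) : v = u ∧ r = 1 ∧ c = 0 := by
  classical
  have hs := congrArg X.freeOne.src h
  have ht := congrArg X.freeOne.tgt h
  simp only [map_add, map_smul, src_cell, hp, hq, src_one, tgt_one] at hs ht
  have hpu := tgt_apply_source hT hL hp
  have hqv := tgt_apply_source hT hL hq
  have hd : Finsupp.single u 1 - X.freeOne.tgt p.cell =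
      r • (Finsupp.single v 1 - X.freeOne.tgt q.cell) := by
    rw [hs, ht, smul_sub]
    abel
  have huv : v = u := by
    -- otherwise each of `u` and `v` occurs in the target of the monomial with the other source
    by_contra hne
    have h1 := DFunLike.congr_fun hd u
    have h2 := DFunLike.congr_fun hd v
    simp [hpu, hqv, hne, Ne.symm hne] at h1 h2
    refine hT.irrefl u (Prec.trans _ _ _ (prec_of_mem_support_tgt hL (v := u) hq ?_)
      (prec_of_mem_support_tgt hL (v := v) hp ?_))
    · rw [Finsupp.mem_support_iff]
      intro h0
      simp [h0] at h1
    · rw [Finsupp.mem_support_iff]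
      intro h0
      rw [h0, neg_zero] at h2
      exact hr h2.symm
  subst huv
  have h1 := DFunLike.congr_fun hd v
  simp [hpu, hqv] at h1
  refine ⟨rfl, h1.symm, ?_⟩
  rw [← h1, one_smul] at hs
  simpa using hs

/-- An intersecting branching of two monomials that is not critical is an instance of a branching of
two monomials with a smaller source. -/
theorem exists_act_of_not_isCritical (hT : X.Terminating) (hL : X.LeftMonomial)
    {p q : X.Monomial n} {u : ShTree X.gen₀ n} (hp : p.source = Finsupp.single u 1)
    (hq : q.source = Finsupp.single u 1) (hi : X.IsIntersecting p.cell q.cell)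
    (hc : ¬ X.IsCritical p.cell q.cell) :
    ∃ (m : ℕ+) (Γ : OneHole X.gen₀ n m) (p' q' : X.Monomial m) (v : ShTree X.gen₀ m),
      p'.source = Finsupp.single v 1 ∧ q'.source = Finsupp.single v 1 ∧ Γ.fill v = u ∧
      v.size < u.size ∧ p.cell = X.freeOne.act Γ p'.cell ∧ q.cell = X.freeOne.act Γ q'.cell := by
  classical
  have hc' : ∃ (m : ℕ+) (f g : X.Cell₁ m), X.IsIntersecting f g ∧
      X.BranchingLE f g p.cell q.cell ∧ ¬ X.BranchingLE p.cell q.cell f g := by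
    by_contra! h
    exact hc ⟨hi, h⟩
  obtain ⟨m, f, g, hfg, ⟨Γ, c, hf, hg⟩, hn⟩ := hc'
  obtain ⟨⟨⟨p', v, r, a, hp', hr, hva, rfl⟩, ⟨q', w, s, b, hq', hs, hwb, rfl⟩, hsrc⟩, -, hadd, -⟩ :=
    hfg
  have hf' : p.cell = r • (p'.act Γ).cell + X.one (Finsupp.mapDomain Γ.fill a + c) := by
    rw [hf, Monomial.cell_act, map_add, map_smul, X.freeOne.ident_act, one, one, map_add,
      add_assoc]
  have hg' : q.cell = s • (q'.act Γ).cell + X.one (Finsupp.mapDomain Γ.fill b + c) := by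
    rw [hg, Monomial.cell_act, map_add, map_smul, X.freeOne.ident_act, one, one, map_add,
      add_assoc]
  obtain ⟨hvu, rfl, hac⟩ :=
    Monomial.eq_of_cell_eq hT hL hr hp (Monomial.source_act Γ hp') hf'
  obtain ⟨hwu, rfl, hbc⟩ :=
    Monomial.eq_of_cell_eq hT hL hs hq (Monomial.source_act Γ hq') hg'
  rw [hac, one, map_zero, add_zero, one_smul, Monomial.cell_act] at hf'
  rw [hbc, one, map_zero, add_zero, one_smul, Monomial.cell_act] at hg'
  simp only [map_add, Monomial.src_cell, hp', hq', src_one, one_smul] at hsrc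
  rw [Finsupp.notMem_support_iff] at hva hwb
  -- if the two sources differed, then `(f, g)` would be additive
  have hvw : v = w := by
    by_contra hne
    refine hadd ⟨p', q', v, w, 1, 1, a - Finsupp.single w 1, hp', hq', one_ne_zero, one_ne_zero,
      hne, ?_, ?_, ?_, ?_⟩
    · simp [hva, Ne.symm hne]
    · have := DFunLike.congr_fun hsrc w
      simp [hwb, hne] at this
      simp [this]
    · simp only [one, map_sub, one_smul]
      abel
    · have hb : b = Finsupp.single v 1 + (a - Finsupp.single w 1) := by
        rw [← add_sub_assoc, hsrc]
        abel
      rw [hb]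
      simp only [one, map_add, map_sub, one_smul]
      abel
  subst hvw
  have hab : a = b := add_left_cancel hsrc
  subst hab
  refine ⟨m, Γ, p', q', v, hp', hq', hvu, ?_, hf', hg'⟩
  have hsize := Γ.size_fill v
  rw [hvu] at hsize
  rcases Nat.eq_zero_or_pos Γ.size with h0 | h0
  · -- a trivial `Γ` would give `f = p + 1_a` and `g = q + 1_a`, so `(p, q) ⊑ (f, g)`
    exfalso
    obtain ⟨rfl, rfl⟩ := Γ.eq_trivial_of_size_eq_zero h0
    simp only [X.freeOne.act_trivial] at hf' hg'
    exact hn ⟨OneHole.trivial _ _, a, by rw [X.freeOne.act_trivial, hf', one_smul],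
      by rw [X.freeOne.act_trivial, hg', one_smul]⟩
  · omega

/-! ### Normal forms -/

/-- Every `0`-cell is the source of a positive `1`-cell whose target is irreducible. -/
theorem exists_isPositive_irreducible (hT : X.Terminating) (hL : X.LeftMonomial) (a : X.Cell₀ n) :
    ∃ h : X.Cell₁ n, X.IsPositive h ∧ X.freeOne.src h = a ∧
      ∀ (p : X.Monomial n) (u : ShTree X.gen₀ n), p.source = Finsupp.single u 1 →
        u ∉ (X.freeOne.tgt h).support := by
  classical
  -- The support is only required to lie in `s`, since a step may also cancel monomials.
  have key : ∀ (s : Multiset (ShTree X.gen₀ n)) (a : X.Cell₀ n), (∀ v ∈ a.support, v ∈ s) →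
      ∃ h : X.Cell₁ n, X.IsPositive h ∧ X.freeOne.src h = a ∧
      ∀ (p : X.Monomial n) (u : ShTree X.gen₀ n), p.source = Finsupp.single u 1 →
        u ∉ (X.freeOne.tgt h).support := by
    intro s
    induction s using (hT n).cutExpand.induction with
    | _ s ih =>
    intro a ha
    by_cases hirr : ∀ (p : X.Monomial n) (u : ShTree X.gen₀ n), p.source = Finsupp.single u 1 →
        u ∉ a.support
    · refine ⟨X.one a, IsPositive.one a, src_one a, ?_⟩
      rwa [tgt_one]
    · push Not at hirr
      obtain ⟨p, u, hp, hu⟩ := hirr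
      have hstep : X.IsStep (a u • p.cell + X.one (a.erase u)) :=
        ⟨p, u, a u, a.erase u, hp, Finsupp.mem_support_iff.1 hu, by simp, rfl⟩
      have hsrc : X.freeOne.src (a u • p.cell + X.one (a.erase u)) = a := by
        rw [map_add, map_smul, Monomial.src_cell, hp, src_one, Finsupp.smul_single, smul_eq_mul,
          mul_one, Finsupp.single_add_erase]
      obtain ⟨h, hpos, hh, hirr⟩ := ih (s.erase u + (X.freeOne.tgt p.cell).support.val)
        ⟨(X.freeOne.tgt p.cell).support.val, u,
          fun v hv => Monomial.prec_of_mem_support_tgt hL hp hv, by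
            rw [add_right_comm, add_comm (s.erase u), Multiset.singleton_add,
              Multiset.cons_erase (ha u hu)]⟩
        (X.freeOne.tgt (a u • p.cell + X.one (a.erase u))) (by
          intro v hv
          rw [map_add, map_smul, tgt_one] at hv
          rw [Multiset.mem_add]
          rcases Finset.mem_union.1 (Finsupp.support_add hv) with hv | hv
          · exact Or.inr (Finsupp.support_smul hv)
          · rw [Finsupp.support_erase, Finset.mem_erase] at hv
            exact Or.inl ((Multiset.mem_erase_of_ne hv.1).2 (ha v hv.2)))
      refine ⟨_, IsPositive.comp _ h hstep hpos hh.symm, by rw [src_comp hh.symm, hsrc], ?_⟩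
      rwa [tgt_comp]
  exact key a.support.val a fun v hv => hv

/-- The displacement of a `1`-cell `f : a → b`: the pair formed by `a - b` and by the class of
`1_a - f` modulo `S`. It turns composition into addition. -/
noncomputable def displacement (S : ∀ n, Submodule K (X.Cell₁ n)) :
    X.Cell₁ n →ₗ[K] X.Cell₀ n × (X.Cell₁ n ⧸ S n) :=
  (X.freeOne.src - X.freeOne.tgt).prod
    ((S n).mkQ ∘ₗ (X.freeOne.ident ∘ₗ X.freeOne.src - LinearMap.id))

theorem displacement_fst (f : X.Cell₁ n) :
    (displacement S f).1 = X.freeOne.src f - X.freeOne.tgt f := rfl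

theorem displacement_snd (f : X.Cell₁ n) :
    (displacement S f).2 = (S n).mkQ (X.one (X.freeOne.src f) - f) := rfl

theorem displacement_one (a : X.Cell₀ n) : displacement S (X.one a) = 0 := by
  refine Prod.ext ?_ ?_
  · rw [displacement_fst, src_one, tgt_one, sub_self]; rfl
  · rw [displacement_snd, src_one, sub_self, map_zero]; rfl

theorem displacement_comp (f g : X.Cell₁ n) :
    displacement S (X.comp f g) = displacement S f + displacement S g := by
  rw [comp, map_add, map_sub, displacement_one, sub_zero]

theorem displacement_mem_span {f : X.Cell₁ n} (hf : X.IsPositive f) :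
    displacement S f ∈
      Submodule.span K (Set.range fun p : X.Monomial n => displacement S p.cell) := by
  induction hf with
  | one a => rw [displacement_one]; exact zero_mem _
  | comp f g hf _ _ ih =>
    rw [displacement_comp]
    refine add_mem ?_ ih
    obtain ⟨p, u, r, c, -, -, -, rfl⟩ := hf
    rw [map_add, map_smul, displacement_one, add_zero]
    exact Submodule.smul_mem _ _ (Submodule.subset_span ⟨p, rfl⟩)

theorem displacement_mem_span_of_mem_lower
    (hsrc : ∀ n, ∀ x ∈ S n, X.freeOne.src x = 0) (htgt : ∀ n, ∀ x ∈ S n, X.freeOne.tgt x = 0)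
    {u : ShTree X.gen₀ n} {x : X.Cell₁ n} (hx : x ∈ lower S u) :
    displacement S x ∈ Submodule.span K {y | ∃ (p : X.Monomial n) (v : ShTree X.gen₀ n),
      p.source = Finsupp.single v 1 ∧ X.Prec v u ∧ displacement S p.cell = y} := by
  have h : lower S u ≤ (Submodule.span K {y | ∃ (p : X.Monomial n) (v : ShTree X.gen₀ n),
      p.source = Finsupp.single v 1 ∧ X.Prec v u ∧ displacement S p.cell = y}).comap
        (displacement S) := by
    refine sup_le (sup_le ?_ ?_) (Submodule.span_le.2 ?_)
    · intro x hx
      rw [Submodule.mem_comap]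
      have h0 : displacement S x = 0 := by
        refine Prod.ext ?_ ?_
        · rw [displacement_fst, hsrc n x hx, htgt n x hx, sub_self]; rfl
        · rw [displacement_snd, hsrc n x hx, one, map_zero, zero_sub, map_neg, neg_eq_zero.2]
          · rfl
          · simpa using hx
      rw [h0]
      exact zero_mem _
    · rintro _ ⟨a, rfl⟩
      rw [Submodule.mem_comap, displacement_one]
      exact zero_mem _
    · rintro _ ⟨p, v, hp, hv, rfl⟩
      exact Submodule.subset_span ⟨p, v, hp, hv, rfl⟩
  exact h hx

/-- If all pairs of monomials with the same source are resolvable, then two positive `1`-cells with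
the same source can be completed to positive `1`-cells that are congruent modulo `S`. -/
theorem exists_comp_sub_comp_mem (hT : X.Terminating) (hL : X.LeftMonomial)
    (hsrc : ∀ n, ∀ x ∈ S n, X.freeOne.src x = 0) (htgt : ∀ n, ∀ x ∈ S n, X.freeOne.tgt x = 0)
    (hres : ∀ (p q : X.Monomial n) (u : ShTree X.gen₀ n), p.source = Finsupp.single u 1 →
      q.source = Finsupp.single u 1 → p.cell - q.cell ∈ lower S u)
    {f g : X.Cell₁ n} (hfg : X.IsBranching f g) :
    ∃ h k : X.Cell₁ n, X.IsPositive h ∧ X.IsPositive k ∧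
      X.freeOne.tgt f = X.freeOne.src h ∧ X.freeOne.tgt g = X.freeOne.src k ∧
      X.freeOne.tgt h = X.freeOne.tgt k ∧ X.comp f h - X.comp g k ∈ S n := by
  classical
  obtain ⟨hf, hg, hs⟩ := hfg
  obtain ⟨h, hh, hfh, hhirr⟩ := exists_isPositive_irreducible hT hL (X.freeOne.tgt f)
  obtain ⟨k, hk, hgk, hkirr⟩ := exists_isPositive_irreducible hT hL (X.freeOne.tgt g)
  choose s hs' using fun p : X.Monomial n => p.exists_source_eq_single hL
  have hzero : displacement S (X.comp f h) - displacement S (X.comp g k) = 0 := by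
    refine eq_zero_of_mem_span_of_irreducible (K := K) X.Prec (hT n) s
      (fun p => displacement S p.cell) ?_ ?_ ?_ ?_
    · intro p v hv
      rw [displacement_fst, Monomial.src_cell, hs', sub_sub_cancel] at hv
      exact Monomial.prec_of_mem_support_tgt hL (hs' p) hv
    · intro p q hpq
      have h1 := displacement_mem_span_of_mem_lower hsrc htgt
        (hres p q (s p) (hs' p) (by rw [hpq, hs']))
      rw [map_sub] at h1
      refine Submodule.span_mono ?_ h1
      rintro _ ⟨p', v, hp', hv, rfl⟩
      rw [hs' p'] at hp'
      rw [← Finsupp.single_left_injective one_ne_zero hp'] at hv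
      exact ⟨p', hv, rfl⟩
    · rw [displacement_comp, displacement_comp]
      exact sub_mem (add_mem (displacement_mem_span hf) (displacement_mem_span hh))
        (add_mem (displacement_mem_span hg) (displacement_mem_span hk))
    · intro p hp
      rw [Prod.fst_sub, displacement_fst, displacement_fst, src_comp hfh.symm, src_comp hgk.symm,
        hs, sub_sub_sub_cancel_left, tgt_comp, tgt_comp] at hp
      rcases Finset.mem_union.1 (Finsupp.support_sub hp) with hp | hp
      · exact hkirr p _ (hs' p) hp
      · exact hhirr p _ (hs' p) hp
  have h1 := congrArg Prod.fst hzero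
  have h2 := congrArg Prod.snd hzero
  rw [Prod.fst_sub, displacement_fst, displacement_fst, src_comp hfh.symm, src_comp hgk.symm,
    hs, sub_sub_sub_cancel_left, tgt_comp, tgt_comp] at h1
  rw [Prod.snd_sub, displacement_snd, displacement_snd, src_comp hfh.symm, src_comp hgk.symm,
    hs, ← map_sub, sub_sub_sub_cancel_left] at h2
  refine ⟨h, k, hh, hk, hfh.symm, hgk.symm, (sub_eq_zero.1 h1).symm, ?_⟩
  rw [← neg_sub, neg_mem_iff]
  exact (Submodule.Quotient.mk_eq_zero _).1 h2

end OnePolygraph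

end ShufflePoly

namespace ShufflePoly

namespace TwoPolygraph

variable {K : Type v} [Field K] (X : TwoPolygraph.{u, v} K) {n m : ℕ+}

/-! ### Boundaries of two-cells -/

/-- The differences `s F - t F` for the `2`-cells `F`. -/
noncomputable def boundaries (n : ℕ+) : Submodule K (X.Cell₁ n) :=
  LinearMap.range (X.source₁ (n := n) - X.target₁)

variable {X}

theorem source₁_act (Γ : OneHole X.gen₀ n m) (F : X.Cell₂ m) :
    X.source₁ (X.freeTwo.act Γ F) = X.freeOne.act Γ (X.source₁ F) := by
  obtain ⟨F, rfl⟩ := Submodule.mkQ_surjective _ F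
  exact X.preSrc.map_act Γ F

theorem target₁_act (Γ : OneHole X.gen₀ n m) (F : X.Cell₂ m) :
    X.target₁ (X.freeTwo.act Γ F) = X.freeOne.act Γ (X.target₁ F) := by
  obtain ⟨F, rfl⟩ := Submodule.mkQ_surjective _ F
  exact X.preTgt.map_act Γ F

theorem src_source₁ (F : X.Cell₂ n) :
    X.freeOne.src (X.source₁ F) = X.freeOne.src (X.target₁ F) := by
  obtain ⟨F, rfl⟩ := Submodule.mkQ_surjective _ F
  exact (X.preSrc.src_map F).trans (X.preTgt.src_map F).symm

theorem tgt_source₁ (F : X.Cell₂ n) :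
    X.freeOne.tgt (X.source₁ F) = X.freeOne.tgt (X.target₁ F) := by
  obtain ⟨F, rfl⟩ := Submodule.mkQ_surjective _ F
  exact (X.preSrc.tgt_map F).trans (X.preTgt.tgt_map F).symm

theorem boundaries_le_comap (Γ : OneHole X.gen₀ n m) :
    X.boundaries m ≤ (X.boundaries n).comap (X.freeOne.act Γ) := by
  rintro _ ⟨F, rfl⟩
  exact ⟨X.freeTwo.act Γ F, by
    rw [LinearMap.sub_apply, LinearMap.sub_apply, map_sub, source₁_act, target₁_act]⟩

theorem src_of_mem_boundaries {x : X.Cell₁ n} (hx : x ∈ X.boundaries n) :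
    X.freeOne.src x = 0 := by
  obtain ⟨F, rfl⟩ := hx
  rw [LinearMap.sub_apply, map_sub, src_source₁, sub_self]

theorem tgt_of_mem_boundaries {x : X.Cell₁ n} (hx : x ∈ X.boundaries n) :
    X.freeOne.tgt x = 0 := by
  obtain ⟨F, rfl⟩ := hx
  rw [LinearMap.sub_apply, map_sub, tgt_source₁, sub_self]

/-- Every `1`-cell has an identity `2`-cell. -/
theorem exists_source₁_eq_target₁_eq (f : X.Cell₁ n) :
    ∃ F : X.Cell₂ n, X.source₁ F = f ∧ X.target₁ F = f :=
  ⟨(X.preTwo.exchangeRel n).mkQ (LinearMap.inr K _ (X.freeOne.Cell n) f),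
    X.freeOne.freeExtend_inr X.gen₂ (fun Δ A => X.freeOne.act Δ (X.src₂ A)) LinearMap.id f,
    X.freeOne.freeExtend_inr X.gen₂ (fun Δ A => X.freeOne.act Δ (X.tgt₂ A)) LinearMap.id f⟩

/-- There is a `2`-cell from `f` to `g` as soon as `f - g` is a boundary: identities may be added to
any `2`-cell. -/
theorem sub_mem_boundaries_iff {f g : X.Cell₁ n} :
    f - g ∈ X.boundaries n ↔ ∃ F : X.Cell₂ n, X.source₁ F = f ∧ X.target₁ F = g := by
  constructor
  · rintro ⟨F, hF⟩
    obtain ⟨G, hG, hG'⟩ := exists_source₁_eq_target₁_eq (f - X.source₁ F)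
    refine ⟨F + G, by rw [map_add, hG, add_sub_cancel], ?_⟩
    rw [LinearMap.sub_apply] at hF
    rw [map_add, hG', add_sub, add_comm, add_sub_assoc, ← neg_sub, hF]
    abel
  · rintro ⟨F, rfl, rfl⟩
    exact ⟨F, rfl⟩

theorem IsCoherentlyConfluentPair.sub_mem_lower (hL : X.LeftMonomial) {p q : X.Monomial n}
    {u : ShTree X.gen₀ n} (hp : p.source = Finsupp.single u 1) (hq : q.source = Finsupp.single u 1)
    (h : X.IsCoherentlyConfluentPair p.cell q.cell) :
    p.cell - q.cell ∈ OnePolygraph.lower X.boundaries u := by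
  obtain ⟨h, k, hh, hk, hph, hqk, -, hF⟩ := h
  have hF' := OnePolygraph.le_lower u (sub_mem_boundaries_iff.2 hF)
  have hh' : h ∈ OnePolygraph.lower X.boundaries u := by
    refine OnePolygraph.mem_lower_of_isPositive hL hh fun v hv => ?_
    rw [← hph] at hv
    exact OnePolygraph.Monomial.prec_of_mem_support_tgt hL hp hv
  have hk' : k ∈ OnePolygraph.lower X.boundaries u := by
    refine OnePolygraph.mem_lower_of_isPositive hL hk fun v hv => ?_
    rw [← hqk] at hv
    exact OnePolygraph.Monomial.prec_of_mem_support_tgt hL hq hv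
  have e : p.cell - q.cell = X.comp p.cell h - X.comp q.cell k
      + X.one (X.freeOne.tgt p.cell) - h - X.one (X.freeOne.tgt q.cell) + k := by
    simp only [OnePolygraph.comp]
    abel
  rw [e]
  exact add_mem (sub_mem (sub_mem (add_mem hF' (OnePolygraph.one_mem_lower _ _)) hh')
    (OnePolygraph.one_mem_lower _ _)) hk'

/-- If every essential branching is coherently confluent, then all pairs of monomials with the same
source are resolvable. The outer induction is on the size of the source, the inner one on the number
of monomials in between. -/
theorem sub_mem_lower_of_essentiallyCoherentlyConfluent
    (hT : X.toOnePolygraph.Terminating) (hL : X.toOnePolygraph.LeftMonomial)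
    (O : X.toOnePolygraph.PathOrder)
    (hfin : ∀ (n : ℕ+) (p q : X.toOnePolygraph.Monomial n),
      X.toOnePolygraph.IsCritical p.cell q.cell → (O.between p q).Finite)
    (hE : X.EssentiallyCoherentlyConfluent O) (p q : X.Monomial n) (u : ShTree X.gen₀ n)
    (hp : p.source = Finsupp.single u 1) (hq : q.source = Finsupp.single u 1) :
    p.cell - q.cell ∈ OnePolygraph.lower X.boundaries u := by
  induction hN : u.size using Nat.strong_induction_on generalizing n u p q with
  | _ N ih =>
  subst hN
  -- Only critical pairs need an argument: the exchange relation settles the multiplicative ones, a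
  -- branching of monomials is never additive, and the others come from smaller sources.
  have reduce : ∀ p q : X.Monomial n, p.source = Finsupp.single u 1 →
      q.source = Finsupp.single u 1 →
      (X.IsCritical p.cell q.cell → p.cell - q.cell ∈ OnePolygraph.lower X.boundaries u) →
      p.cell - q.cell ∈ OnePolygraph.lower X.boundaries u := by
    intro p q hp hq hcrit
    by_cases hne : p.cell = q.cell
    · rw [hne, sub_self]
      exact zero_mem _
    by_cases hm : X.IsMultiplicative p.cell q.cell
    · exact OnePolygraph.sub_mem_lower_of_isMultiplicative hL hp hm
    by_cases hc : X.IsCritical p.cell q.cell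
    · exact hcrit hc
    obtain ⟨m, Γ, p', q', v, hp', hq', rfl, hlt, hpe, hqe⟩ :=
      OnePolygraph.exists_act_of_not_isCritical hT hL hp hq
        ⟨OnePolygraph.isLocalBranching_cell hp hq, hne,
          OnePolygraph.not_isAdditive_cell hp, hm⟩ hc
    rw [hpe, hqe, ← map_sub]
    exact OnePolygraph.act_mem_lower boundaries_le_comap Γ (ih _ hlt p' q' v hp' hq' rfl)
  have finite : ∀ (N : ℕ) (p q : X.Monomial n), p.source = Finsupp.single u 1 →
      q.source = Finsupp.single u 1 → O.Lt p q → (O.between p q).Finite →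
      (O.between p q).ncard = N → p.cell - q.cell ∈ OnePolygraph.lower X.boundaries u := by
    intro N
    induction N using Nat.strong_induction_on with
    | _ N ihN =>
    rintro p q hp hq hlt hf rfl
    rcases Set.eq_empty_or_nonempty (O.between p q) with h0 | ⟨r, hr, hpr, hrq⟩
    · -- a critical pair with nothing in between is essential
      refine reduce p q hp hq fun hc => ?_
      exact (hE n _ p q ⟨hc, hlt, h0⟩ rfl).sub_mem_lower hL hp hq
    · have hr' : r.source = Finsupp.single u 1 := hr.trans hp
      have hmem : r ∈ O.between p q := ⟨hr, hpr, hrq⟩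
      have h1 : O.between p r ⊂ O.between p q := by
        have hsub : O.between p r ⊆ O.between p q := fun s hs =>
          ⟨hs.1, hs.2.1, O.lt_trans hs.2.2 hrq⟩
        exact (Set.ssubset_iff_of_subset hsub).2 ⟨r, hmem, fun h => O.lt_irrefl r h.2.2⟩
      have h2 : O.between r q ⊂ O.between p q := by
        have hsub : O.between r q ⊆ O.between p q := fun s hs =>
          ⟨hs.1.trans hr, O.lt_trans hpr hs.2.1, hs.2.2⟩
        exact (Set.ssubset_iff_of_subset hsub).2 ⟨r, hmem, fun h => O.lt_irrefl r h.2.1⟩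
      have e1 := ihN _ (Set.ncard_lt_ncard h1 hf) p r hp hr' hpr (hf.subset h1.subset) rfl
      have e2 := ihN _ (Set.ncard_lt_ncard h2 hf) r q hr' hq hrq (hf.subset h2.subset) rfl
      rw [← sub_add_sub_cancel p.cell r.cell q.cell]
      exact add_mem e1 e2
  have ordered : ∀ p q : X.Monomial n, p.source = Finsupp.single u 1 →
      q.source = Finsupp.single u 1 → O.Lt p q →
      p.cell - q.cell ∈ OnePolygraph.lower X.boundaries u := fun p q hp hq hlt =>
    reduce p q hp hq fun hc => finite _ p q hp hq hlt (hfin n p q hc) rfl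
  rcases O.lt_trichotomy p q with h | rfl | h
  · exact ordered p q hp hq h
  · rw [sub_self]
    exact zero_mem _
  · rw [← neg_sub, neg_mem_iff]
    exact ordered q p hq hp h

end TwoPolygraph

end ShufflePoly

theorem theoremT {K : Type v} [Field K] [CharZero K] (X : ShufflePoly.TwoPolygraph.{u, v} K)
    (hT : X.toOnePolygraph.Terminating) (hL : X.toOnePolygraph.LeftMonomial)
    (O : X.toOnePolygraph.PathOrder)
    (hfin : ∀ (n : ℕ+) (p q : X.toOnePolygraph.Monomial n),
      X.toOnePolygraph.IsCritical p.cell q.cell → (O.between p q).Finite)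
    (hE : X.EssentiallyCoherentlyConfluent O) :
    X.CoherentlyConfluent := by
  intro n a f g hfg _
  obtain ⟨h, k, hh, hk, hfh, hgk, hhk, hS⟩ := ShufflePoly.OnePolygraph.exists_comp_sub_comp_mem
    hT hL (fun _ _ => ShufflePoly.TwoPolygraph.src_of_mem_boundaries)
    (fun _ _ => ShufflePoly.TwoPolygraph.tgt_of_mem_boundaries)
    (X.sub_mem_lower_of_essentiallyCoherentlyConfluent hT hL O hfin hE) hfg
  exact ⟨h, k, hh, hk, hfh, hgk, hhk, ShufflePoly.TwoPolygraph.sub_mem_boundaries_iff.1 hS⟩
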